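/- A co-Heyting algebra is a bounded distributive lattice $(L,\mathbf 0,\mathbf 1,\vee,\wedge)$ with a binary operation $a-b=\min\{c : a\le b\vee c\}$; we work in the first-order language $\{\mathbf 0,\mathbf 1,\vee,\wedge,-\}$. Write $a\bigtriangleup b=(a-b)\vee(b-a)$, and $b\ll a$ if $a-b=a\ge b$. Let $\mathcal V_4$ be the variety of co-Heyting algebras satisfying the two identities $$\big(((\mathbf 1-x)\wedge x)-y\big)\wedge y=\mathbf 0,\qquad (x-y)\wedge(y-x)\wedge\big(x\bigtriangleup(\mathbf 1-y)\big)=\mathbf 0 .$$ Theorem. (a) $\mathcal V_4$ is the variety generated by $\mathbf L_5$, the five-element co-Heyting algebra $\mathbf 0<c<p,q<\mathbf 1$ with $p\wedge q=c$ and $p\vee q=\mathbf 1$; that is, $\mathcal V_4$ is the class of all algebras satisfying every identity valid in $\mathbf L_5$. (b) The theory of $\mathcal V_4$ has a model-completion, and it is axiomatised by the axioms of $\mathcal V_4$ together with the following two axioms. [Density D4] For every $a$ such that $a=\mathbf 1-(\mathbf 1-a)\ne\mathbf 0$ there exists $b\neq\mathbf 0$ such that $b\ll a$. [Splitting S4]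 For all $a,b_1,b_2$ such that $b_1\vee b_2\ll a\ne\mathbf 0$ and $b_1\wedge b_2\wedge(\mathbf 1-a)=\mathbf 0$ there exist $a_1\neq\mathbf 0$ and $a_2\ne\mathbf 0$ such that $$a-a_2=a_1\ge b_1,\qquad a-a_1=a_2\ge b_2,\qquad a_1\wedge a_2=b_1\wedge b_2 .$$ Here (b) means: an algebra is an existentially closed model of the theory of $\mathcal V_4$ if and only if it belongs to $\mathcal V_4$ and satisfies D4 and S4; and the theory of $\mathcal V_4$ together with D4 and S4 eliminates quantifiers. -/

import Mathlib

universe u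

namespace CoHA

open FirstOrder FirstOrder.Language

section ModelTheory

variable {L : FirstOrder.Language.{0, 0}}

/-- `M` is an existentially closed model of `T`: it is a model of `T`, and every existential formula
with parameters in `M` that holds in some extension of `M` which is a model of `T` holds in `M`. -/
def IsExistentiallyClosed (T : L.Theory) (M : Type u) [L.Structure M] : Prop :=
  T.Model M ∧
    ∀ (N : Type u) [L.Structure N], T.Model N → ∀ (f : M ↪[L] N) (n : ℕ) (φ : L.Formula (Fin n)),
      BoundedFormula.IsExistential φ →
        ∀ a : Fin n → M, φ.Realize (fun i => f (a i)) → φ.Realize a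

/-- Every formula is equivalent modulo `T` to a quantifier-free formula in the same variables. -/
def EliminatesQuantifiers (T : L.Theory) : Prop :=
  ∀ (n : ℕ) (φ : L.Formula (Fin n)),
    ∃ ψ : L.Formula (Fin n), BoundedFormula.IsQF ψ ∧ T ⊨ᵇ BoundedFormula.iff φ ψ

/-- `T'` axiomatises the model completion of the (universal) theory `T`: the models of `T'` are
exactly the existentially closed models of `T` (so `T'` is the model companion of `T`), and `T'`
eliminates quantifiers. -/
structure IsModelCompletion (T T' : L.Theory) : Prop where
  model_iff : ∀ (M : Type u) [L.Structure M], T'.Model M ↔ IsExistentiallyClosed.{u} T M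
  elim : EliminatesQuantifiers T'

end ModelTheory

/-- The function symbols `0`, `1`, `∨`, `∧`, `-` of co-Heyting algebras. -/
inductive Func : ℕ → Type
  | zero : Func 0
  | one : Func 0
  | sup : Func 2
  | inf : Func 2
  | sub : Func 2

/-- The language of co-Heyting algebras. -/
def lang : FirstOrder.Language.{0, 0} where
  Functions := Func
  Relations := fun _ => Empty

/-- A co-Heyting algebra as a structure in the language `lang`; the symbol `-` is interpreted by the
operation `a \ b = min {c | a ≤ b ⊔ c}`. -/
abbrev structureOfCoheyting (A : Type u) [CoheytingAlgebra A] : lang.Structure A where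
  funMap := fun {_} f => match f with
    | Func.zero => fun _ => ⊥
    | Func.one => fun _ => ⊤
    | Func.sup => fun x => x 0 ⊔ x 1
    | Func.inf => fun x => x 0 ⊓ x 1
    | Func.sub => fun x => x 0 \ x 1
  RelMap := fun {_} r => r.elim

/-- The symbol `0`. -/
abbrev zeroSymb : lang.Constants := Func.zero
/-- The symbol `1`. -/
abbrev oneSymb : lang.Constants := Func.one
/-- The symbol `∨`. -/
abbrev supSymb : lang.Functions 2 := Func.sup
/-- The symbol `∧`. -/
abbrev infSymb : lang.Functions 2 := Func.inf
/-- The symbol `-`. -/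
abbrev subSymb : lang.Functions 2 := Func.sub

section Formulas

variable {α : Type*}

instance : Zero (lang.Term α) := ⟨Constants.term zeroSymb⟩
instance : One (lang.Term α) := ⟨Constants.term oneSymb⟩
instance : Max (lang.Term α) := ⟨Functions.apply₂ supSymb⟩
instance : Min (lang.Term α) := ⟨Functions.apply₂ infSymb⟩
instance : Sub (lang.Term α) := ⟨Functions.apply₂ subSymb⟩

/-- The topological symmetric difference `(s - t) ∨ (t - s)`. -/
def symDiffTerm (s t : lang.Term α) : lang.Term α := (s - t) ⊔ (t - s)

variable {n : ℕ}

/-- The formula `s ≤ t`. -/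
def leF (s t : lang.Term (α ⊕ Fin n)) : lang.BoundedFormula α n := (s ⊓ t) =' s

/-- The formula `s ≠ 0`. -/
def neZeroF (s : lang.Term (α ⊕ Fin n)) : lang.BoundedFormula α n := ∼(s =' 0)

/-- The formula `s ≪ t`, that is `t - s = t ≥ s`. -/
def llF (s t : lang.Term (α ⊕ Fin n)) : lang.BoundedFormula α n := ((t - s) =' t) ⊓ leF s t

end Formulas

/-- Variables of identities and sentences. -/
abbrev var {n : ℕ} (i : Fin n) : lang.Term (Empty ⊕ Fin n) := Term.var (Sum.inr i)

/-- The identity `∀ x₀ x₁ x₂, s = t`. -/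
def identity (s t : lang.Term (Empty ⊕ Fin 3)) : lang.Sentence := (s =' t).alls

section Axioms

local notation "x" => (var 0 : lang.Term (Empty ⊕ Fin 3))
local notation "y" => (var 1 : lang.Term (Empty ⊕ Fin 3))
local notation "z" => (var 2 : lang.Term (Empty ⊕ Fin 3))

/-- The variety of all co-Heyting algebras: identities of bounded distributive lattices together
with identities characterising the operation `-`. -/
def V1 : lang.Theory :=
  { identity (x ⊔ y) (y ⊔ x),
    identity (x ⊓ y) (y ⊓ x),
    identity (x ⊔ (y ⊔ z)) ((x ⊔ y) ⊔ z),
    identity (x ⊓ (y ⊓ z)) ((x ⊓ y) ⊓ z),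
    identity (x ⊔ (x ⊓ y)) x,
    identity (x ⊓ (x ⊔ y)) x,
    identity (x ⊓ (y ⊔ z)) ((x ⊓ y) ⊔ (x ⊓ z)),
    identity (x ⊔ 0) x,
    identity (x ⊓ 1) x,
    identity (x - x) 0,
    identity (x ⊔ (y - x)) (x ⊔ y),
    identity (y ⊔ (y - x)) y,
    identity ((y ⊔ z) - x) ((y - x) ⊔ (z - x)) }

/-- The variety of co-Heyting algebras of dimension at most `1`. -/
def V3 : lang.Theory :=
  V1 ∪ { identity ((((1 - x) ⊓ x) - y) ⊓ y) 0 }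

/-- The fourth of Maksimova's varieties (in dual form). -/
def V4 : lang.Theory :=
  V3 ∪ { identity (((x - y) ⊓ (y - x)) ⊓ symDiffTerm x (1 - y)) 0 }

end Axioms

section DensitySplitting

local notation "a" => (var 0)

/-- Density: for every `a` with `a = 1 - (1 - a) ≠ 0` there is `b ≠ 0` with `b ≪ a`. -/
def D4 : lang.Sentence :=
  ∀' ((((a : lang.Term (Empty ⊕ Fin 1)) =' (1 - (1 - a))) ⊓ neZeroF a) ⟹
    ∃' (neZeroF (var 1) ⊓ llF (var 1) a))

local notation "b₁" => (var 1)
local notation "b₂" => (var 2)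
local notation "a₁" => (var 3)
local notation "a₂" => (var 4)

/-- Splitting: for all `a, b₁, b₂` with `b₁ ∨ b₂ ≪ a ≠ 0` and `b₁ ∧ b₂ ∧ (1 - a) = 0` there are
`a₁ ≠ 0` and `a₂ ≠ 0` with `a - a₂ = a₁ ≥ b₁`, `a - a₁ = a₂ ≥ b₂` and `a₁ ∧ a₂ = b₁ ∧ b₂`. -/
def S4 : lang.Sentence :=
  ∀' ∀' ∀' ((llF (b₁ ⊔ b₂) (a : lang.Term (Empty ⊕ Fin 3)) ⊓ neZeroF a ⊓
      (((b₁ ⊓ b₂) ⊓ (1 - a)) =' 0)) ⟹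
    ∃' ∃' (neZeroF (a₁ : lang.Term (Empty ⊕ Fin 5)) ⊓ neZeroF a₂ ⊓
      (((a - a₂) =' a₁) ⊓ leF b₁ a₁) ⊓
      (((a - a₁) =' a₂) ⊓ leF b₂ a₂) ⊓
      ((a₁ ⊓ a₂) =' (b₁ ⊓ b₂))))

end DensitySplitting

/-- The five-element lattice `0 < c < a, b < 1` with `a ∧ b = c` and `a ∨ b = 1`: the square
`Bool × Bool` with a new least element. -/
abbrev L5 : Type := WithBot (Bool × Bool)

noncomputable instance : CoheytingAlgebra L5 :=
  CoheytingAlgebra.ofSDiff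
    (fun s t => if s ≤ t then ⊥ else
      match s, t with
      | s, ⊥ => s
      | ⊥, _ => ⊥
      | (p : Bool × Bool), (q : Bool × Bool) => ((p \ q : Bool × Bool) : WithBot (Bool × Bool)))
    (by decide)

noncomputable instance : lang.Structure L5 := structureOfCoheyting L5

/-- `A` belongs to the variety generated by `B`: it satisfies every identity valid in `B`. -/
def InVarietyGeneratedBy (B : Type) [lang.Structure B] (A : Type u) [lang.Structure A] : Prop :=
  ∀ s t : lang.Term ℕ, (∀ v : ℕ → B, s.realize v = t.realize v) →
    ∀ v : ℕ → A, s.realize v = t.realize v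

end CoHA

/-! ### The algebra `L5` and its dual forest: one root below two leaves. -/

namespace CoHA

open FirstOrder FirstOrder.Language

/-! Homomorphisms to `L5` play the part of points of the dual space. The two identities force the
prime ideals to look locally like the dual of `L5`: chains have at most two members, and at most two
maximal ideals lie above a given prime. So every prime ideal is the root of a homomorphism to `L5`
(`InV4.exists_hom`), and these homomorphisms separate elements (`InV4.eq_iff`). This gives (a) and
turns inequalities into propositional checks at a root and its leaves.

For (b), the type of a point `h` over a tuple `x` is `h ∘ x`. A finite tuple has finitely many
possible types, and whether one is realised is the nonvanishing of a term (`exists_comp_eq_iff`).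
Tuples realising the same types are similar (`Sim`); they satisfy the same quantifier-free formulas.
The core is `Sim.exists_cons`: if `x` in a model of density and splitting is similar to `y` in any
algebra `N` of the variety, then each `n` in `N` has a counterpart. For this the type elements of
the tuple formed by `n` and `y` are adjoined one by one: those without leaves
(`Sim.exists_cons_of_not_pt`, using density and splitting), then closures of sets of maximal points
(`Sim.exists_cons_of_maxLocated`, using splitting). The element `n` is a join of them.

Hence existential formulas descend to models of the axioms, which are thus existentially closed;
back and forth shows that the realised types decide every formula, which gives quantifier
elimination. Conversely, an algebra of the variety embeds in a power of `L5` with two coordinates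
for each homomorphism. Witnesses for density and splitting are written down there, and existential
closedness pulls them back. -/

/-- The root of the three-element forest dual to `L5` lies in `t`. -/
def Rt (t : L5) : Prop := t ≠ ⊥
/-- The first leaf of the forest dual to `L5` lies in `t`. -/
def Pt (t : L5) : Prop := ((true, false) : Bool × Bool) ≤ t
/-- The second leaf of the forest dual to `L5` lies in `t`. -/
def Qt (t : L5) : Prop := ((false, true) : Bool × Bool) ≤ t

instance : DecidablePred Rt := fun t => inferInstanceAs (Decidable (t ≠ ⊥))
instance : DecidablePred Pt :=
  fun t => inferInstanceAs (Decidable (((true, false) : Bool × Bool) ≤ t))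
instance : DecidablePred Qt :=
  fun t => inferInstanceAs (Decidable (((false, true) : Bool × Bool) ≤ t))

instance : Fintype L5 := inferInstanceAs (Fintype (Option (Bool × Bool)))

theorem Pt.rt {t : L5} : Pt t → Rt t := by revert t; decide
theorem Qt.rt {t : L5} : Qt t → Rt t := by revert t; decide

@[simp] theorem rt_bot : ¬ Rt ⊥ := by decide
@[simp] theorem pt_bot : ¬ Pt ⊥ := by decide
@[simp] theorem qt_bot : ¬ Qt ⊥ := by decide
@[simp] theorem rt_top : Rt ⊤ := by decide
@[simp] theorem pt_top : Pt ⊤ := by decide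
@[simp] theorem qt_top : Qt ⊤ := by decide
@[simp] theorem rt_sup (s t : L5) : Rt (s ⊔ t) ↔ Rt s ∨ Rt t := by revert s t; decide
@[simp] theorem pt_sup (s t : L5) : Pt (s ⊔ t) ↔ Pt s ∨ Pt t := by revert s t; decide
@[simp] theorem qt_sup (s t : L5) : Qt (s ⊔ t) ↔ Qt s ∨ Qt t := by revert s t; decide
@[simp] theorem rt_inf (s t : L5) : Rt (s ⊓ t) ↔ Rt s ∧ Rt t := by revert s t; decide
@[simp] theorem pt_inf (s t : L5) : Pt (s ⊓ t) ↔ Pt s ∧ Pt t := by revert s t; decide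
@[simp] theorem qt_inf (s t : L5) : Qt (s ⊓ t) ↔ Qt s ∧ Qt t := by revert s t; decide
@[simp] theorem rt_sdiff (s t : L5) :
    Rt (s \ t) ↔ (Rt s ∧ ¬ Rt t) ∨ (Pt s ∧ ¬ Pt t) ∨ (Qt s ∧ ¬ Qt t) := by revert s t; decide
@[simp] theorem pt_sdiff (s t : L5) : Pt (s \ t) ↔ Pt s ∧ ¬ Pt t := by revert s t; decide
@[simp] theorem qt_sdiff (s t : L5) : Qt (s \ t) ↔ Qt s ∧ ¬ Qt t := by revert s t; decide

theorem L5.ext_iff {s t : L5} :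
    s = t ↔ (Rt s ↔ Rt t) ∧ (Pt s ↔ Pt t) ∧ (Qt s ↔ Qt t) := by revert s t; decide

/-- The automorphism of `L5` exchanging the two atoms above `c`. -/
def swapHom : CoheytingHom L5 L5 where
  toFun := WithBot.map Prod.swap
  map_sup' := by decide
  map_inf' := by decide
  map_top' := by decide
  map_sdiff' := by decide

/-- The endomorphism of `L5` evaluating at the first leaf. -/
def fstHom : CoheytingHom L5 L5 where
  toFun t := if Pt t then ⊤ else ⊥
  map_sup' := by decide
  map_inf' := by decide
  map_top' := by decide
  map_sdiff' := by decide

/-- The endomorphism of `L5` evaluating at the second leaf. -/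
def sndHom : CoheytingHom L5 L5 where
  toFun t := if Qt t then ⊤ else ⊥
  map_sup' := by decide
  map_inf' := by decide
  map_top' := by decide
  map_sdiff' := by decide

@[simp] theorem rt_swap (t : L5) : Rt (swapHom t) ↔ Rt t := by revert t; decide
@[simp] theorem pt_swap (t : L5) : Pt (swapHom t) ↔ Qt t := by revert t; decide
@[simp] theorem qt_swap (t : L5) : Qt (swapHom t) ↔ Pt t := by revert t; decide
@[simp] theorem rt_fst (t : L5) : Rt (fstHom t) ↔ Pt t := by revert t; decide
@[simp] theorem pt_fst (t : L5) : Pt (fstHom t) ↔ Pt t := by revert t; decide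
@[simp] theorem qt_fst (t : L5) : Qt (fstHom t) ↔ Pt t := by revert t; decide
@[simp] theorem rt_snd (t : L5) : Rt (sndHom t) ↔ Qt t := by revert t; decide
@[simp] theorem pt_snd (t : L5) : Pt (sndHom t) ↔ Qt t := by revert t; decide
@[simp] theorem qt_snd (t : L5) : Qt (sndHom t) ↔ Qt t := by revert t; decide

/-- The element of `L5` with prescribed values at the three points. -/
noncomputable def L5.ofPoints (r p q : Prop) : L5 := by
  classical exact if r then ((decide p, decide q) : Bool × Bool) else ⊥

theorem rt_ofPoints {r p q : Prop} : Rt (L5.ofPoints r p q) ↔ r := by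
  unfold L5.ofPoints Rt; split_ifs <;> simp_all

theorem pt_ofPoints {r p q : Prop} (hp : p → r) : Pt (L5.ofPoints r p q) ↔ p := by
  unfold L5.ofPoints Pt
  split_ifs with hr
  · rw [WithBot.coe_le_coe, Prod.mk_le_mk]
    by_cases p <;> by_cases q <;> simp [*]
  · exact ⟨fun h => absurd h (by decide), fun h => absurd (hp h) hr⟩

theorem qt_ofPoints {r p q : Prop} (hq : q → r) : Qt (L5.ofPoints r p q) ↔ q := by
  unfold L5.ofPoints Qt
  split_ifs with hr
  · rw [WithBot.coe_le_coe, Prod.mk_le_mk]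
    by_cases p <;> by_cases q <;> simp [*]
  · exact ⟨fun h => absurd h (by decide), fun h => absurd (hq h) hr⟩

/-- The two identities defining `V4` among co-Heyting algebras. -/
structure InV4 (A : Type*) [CoheytingAlgebra A] : Prop where
  dim : ∀ x y : A, (((⊤ \ x) ⊓ x) \ y) ⊓ y = ⊥
  width : ∀ x y : A, ((x \ y) ⊓ (y \ x)) ⊓ ((x \ (⊤ \ y)) ⊔ ((⊤ \ y) \ x)) = ⊥

theorem inV4_L5 : InV4 L5 := by
  constructor
  · intro x y
    rw [L5.ext_iff]
    simp [-top_sdiff']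
  · intro x y
    rw [L5.ext_iff]
    simp [-top_sdiff']
    grind [Pt.rt, Qt.rt]

/-! ### Prime ideals and homomorphisms to `L5`. -/

section Representation

variable {A : Type u} [CoheytingAlgebra A]

open Order

theorem exists_prime_le_notMem {I : Ideal A} {a : A} (ha : a ∉ I) :
    ∃ J : Ideal A, J.IsPrime ∧ I ≤ J ∧ a ∉ J := by
  obtain ⟨J, hJ, hIJ, hd⟩ := DistribLattice.prime_ideal_of_disjoint_filter_ideal
    (F := PFilter.principal a) (I := I) (by
      rw [Set.disjoint_left]
      intro x hx hxI
      exact ha (I.lower (PFilter.mem_principal.1 hx) hxI))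
  exact ⟨J, hJ, hIJ, fun h => Set.disjoint_left.1 hd (PFilter.mem_principal.2 le_rfl) h⟩

theorem mem_of_sdiff_mem {I : Ideal A} {a b : A} (hb : b ∈ I) (h : a \ b ∈ I) : a ∈ I :=
  I.lower (le_sup_sdiff : a ≤ b ⊔ a \ b) (Ideal.sup_mem hb h)

/-- Separating `a` from the ideal generated by `I` and `b` gives the prime. This dual description of
subtraction is what makes the maps to `L5` below preserve `\`. -/
theorem sdiff_notMem_iff {I : Ideal A} {a b : A} :
    a \ b ∉ I ↔ ∃ J : Ideal A, J.IsPrime ∧ I ≤ J ∧ a ∉ J ∧ b ∈ J := by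
  constructor
  · intro h
    have ha : a ∉ I ⊔ Ideal.principal b := by
      intro ha
      rw [Lattice.mem_ideal_sup_principal] at ha
      obtain ⟨j, hj, hab⟩ := ha
      exact h (I.lower (sdiff_le_iff.2 (by rwa [sup_comm])) hj)
    obtain ⟨J, hJ, hIJ, haJ⟩ := exists_prime_le_notMem ha
    exact ⟨J, hJ, le_sup_left.trans hIJ, haJ,
      hIJ (Ideal.mem_sup.2 ⟨⊥, I.bot_mem, b, by simp, by simp⟩)⟩
  · rintro ⟨J, -, hIJ, ha, hb⟩ h
    exact ha (mem_of_sdiff_mem hb (hIJ h))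

theorem top_sdiff_mem {I : Ideal A} (hI : I.IsMaximal) {a : A} (ha : a ∉ I) : ⊤ \ a ∈ I := by
  by_contra h
  obtain ⟨J, hJ, hIJ, -, haJ⟩ := sdiff_notMem_iff.1 h
  rcases eq_or_lt_of_le hIJ with rfl | hlt
  · exact ha haJ
  · exact hJ.toIsProper.ne_univ (hI.maximal_proper hlt)

/-- In a chain `I < J < K`, take `x` in `K` outside `J` and `y` in `J` outside `I`. Both `x` and `⊤
\ x` lie outside `J`, so subtracting `y` from their meet leaves an element outside `I`, against the
first identity. -/
theorem InV4.isMaximal_of_lt (hA : InV4 A) {I J : Ideal A} (hI : I.IsPrime) (hJ : J.IsPrime)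
    (h : I < J) : J.IsMaximal := by
  obtain ⟨K, hJK, hK⟩ := hJ.toIsProper.exists_le_maximal
  rcases eq_or_lt_of_le hJK with rfl | hlt
  · exact hK
  exfalso
  obtain ⟨y, hyJ, hyI⟩ := Set.exists_of_ssubset h
  obtain ⟨x, hxK, hxJ⟩ := Set.exists_of_ssubset hlt
  have h1 : ⊤ \ x ∉ J := fun h1 => Ideal.IsProper.top_notMem hK.toIsProper
    (mem_of_sdiff_mem hxK (hJK h1))
  have h2 : ⊤ \ x ⊓ x ∉ J := fun h2 => (hJ.mem_or_mem h2).elim h1 hxJ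
  have h3 : (⊤ \ x ⊓ x) \ y ∉ I := fun h3 => h2 (mem_of_sdiff_mem hyJ (h.le h3))
  exact (hI.mem_or_mem (hA.dim x y ▸ I.bot_mem)).elim h3 hyI

theorem exists_mem_notMem_notMem {U V W : Ideal A} (hU : ¬ U ≤ V) (hW : ¬ U ≤ W) :
    ∃ x ∈ U, x ∉ V ∧ x ∉ W := by
  obtain ⟨a, ha, ha'⟩ := Set.not_subset.1 hU
  obtain ⟨b, hb, hb'⟩ := Set.not_subset.1 hW
  exact ⟨a ⊔ b, Ideal.sup_mem ha hb, fun h => ha' (V.lower le_sup_left h),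
    fun h => hb' (W.lower le_sup_right h)⟩

theorem Ideal.IsMaximal.eq_of_le' {U V : Ideal A} (hU : U.IsMaximal) (hV : V.IsMaximal)
    (h : U ≤ V) : U = V := by
  rcases eq_or_lt_of_le h with h | h
  · exact h
  · exact absurd (hU.maximal_proper h) hV.toIsProper.ne_univ

/-- Given three maximal ideals above `I`, take `x` in `V` only and `y` in `U` only. Then `x \ y`, `y
\ x` and `x \ (⊤ \ y)` lie outside `I`, as seen at `U`, `V` and `W` respectively, against the second
identity. -/
theorem InV4.eq_or_eq_of_isMaximal (hA : InV4 A) {I U V W : Ideal A} (hI : I.IsPrime)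
    (hU : U.IsMaximal) (hV : V.IsMaximal) (hW : W.IsMaximal) (hIU : I ≤ U) (hIV : I ≤ V)
    (hIW : I ≤ W) (hUV : U ≠ V) : W = U ∨ W = V := by
  by_contra! hne
  have key : ∀ {S T : Ideal A}, S.IsMaximal → T.IsMaximal → S ≠ T → ¬ S ≤ T :=
    fun hS hT h h' => h (Ideal.IsMaximal.eq_of_le' hS hT h')
  obtain ⟨x, hxV, hxU, hxW⟩ := exists_mem_notMem_notMem (key hV hU hUV.symm) (key hV hW hne.2.symm)
  obtain ⟨y, hyU, hyV, hyW⟩ := exists_mem_notMem_notMem (key hU hV hUV) (key hU hW hne.1.symm)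
  have h1 : x \ y ∉ I := fun h => hxU (mem_of_sdiff_mem hyU (hIU h))
  have h2 : y \ x ∉ I := fun h => hyV (mem_of_sdiff_mem hxV (hIV h))
  have h3 : x \ (⊤ \ y) ∉ I := fun h => hxW (mem_of_sdiff_mem (top_sdiff_mem hW hyW) (hIW h))
  rcases hI.mem_or_mem (hA.width x y ▸ I.bot_mem) with h | h
  · exact (hI.mem_or_mem h).elim h1 h2
  · exact h3 (I.lower le_sup_left h)

/-- A prime ideal `I` below the maximal ideals `U` and `V` and no other proper prime ideal defines a
morphism to `L5`. -/
theorem exists_hom_of_ideals {I U V : Ideal A} (hI : I.IsPrime) (hU : U.IsPrime) (hV : V.IsPrime)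
    (hIU : I ≤ U) (hIV : I ≤ V) (hU' : U.IsMaximal) (hV' : V.IsMaximal)
    (hIJ : ∀ J : Ideal A, J.IsPrime → I ≤ J → J = I ∨ J = U ∨ J = V) :
    ∃ h : CoheytingHom A L5, ∀ a, Rt (h a) ↔ a ∉ I := by
  -- The root goes to `I`, the leaves to `U` and `V`. Coincidences are allowed, so a prime below a
  -- single maximal ideal needs no smaller target.
  let f : A → L5 := fun a => L5.ofPoints (a ∉ I) (a ∉ U) (a ∉ V)
  have hr : ∀ a, Rt (f a) ↔ a ∉ I := fun a => rt_ofPoints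
  have hp : ∀ a, Pt (f a) ↔ a ∉ U := fun a => pt_ofPoints fun h h' => h (hIU h')
  have hq : ∀ a, Qt (f a) ↔ a ∉ V := fun a => qt_ofPoints fun h h' => h (hIV h')
  have hsup : ∀ (J : Ideal A) (a b : A), a ⊔ b ∉ J ↔ a ∉ J ∨ b ∉ J := fun J a b => by
    rw [Ideal.sup_mem_iff]; tauto
  have hinf : ∀ (J : Ideal A), J.IsPrime → ∀ (a b : A), a ⊓ b ∉ J ↔ a ∉ J ∧ b ∉ J :=
    fun J hJ a b => ⟨fun h => ⟨fun h' => h (J.lower inf_le_left h'),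
      fun h' => h (J.lower inf_le_right h')⟩, fun h h' => (hJ.mem_or_mem h').elim h.1 h.2⟩
  have hmax : ∀ (W J : Ideal A), W.IsMaximal → J.IsPrime → W ≤ J → J = W := by
    intro W J hW hJ h
    rcases eq_or_lt_of_le h with h | h
    · exact h.symm
    · exact absurd (hW.maximal_proper h) hJ.toIsProper.ne_univ
  have hsd : ∀ (W : Ideal A), W.IsMaximal → W.IsPrime →
      ∀ a b : A, a \ b ∉ W ↔ a ∉ W ∧ ¬ b ∉ W := by
    intro W hW hW' a b
    rw [sdiff_notMem_iff, not_not]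
    constructor
    · rintro ⟨J, hJ, hWJ, h⟩
      rwa [hmax W J hW hJ hWJ] at h
    · intro h
      exact ⟨W, hW', le_rfl, h⟩
  refine ⟨⟨⟨⟨f, fun a b => ?_⟩, fun a b => ?_⟩, ?_, fun a b => ?_⟩, hr⟩
  · rw [L5.ext_iff]
    simp only [rt_sup, pt_sup, qt_sup, hr, hp, hq, hsup, and_self]
  · change f (a ⊓ b) = f a ⊓ f b
    rw [L5.ext_iff]
    simp only [rt_inf, pt_inf, qt_inf, hr, hp, hq, hinf I hI, hinf U hU, hinf V hV, and_self]
  · change f ⊤ = ⊤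
    rw [L5.ext_iff]
    simp only [hr, hp, hq, rt_top, pt_top, qt_top, iff_true]
    exact ⟨hI.toIsProper.top_notMem, hU.toIsProper.top_notMem, hV.toIsProper.top_notMem⟩
  · change f (a \ b) = f a \ f b
    rw [L5.ext_iff]
    simp only [rt_sdiff, pt_sdiff, qt_sdiff, hr, hp, hq, hsd U hU' hU, hsd V hV' hV, and_self,
      and_true]
    rw [sdiff_notMem_iff]
    constructor
    · rintro ⟨J, hJ, hIJ', h⟩
      rcases hIJ J hJ hIJ' with rfl | rfl | rfl <;> simp [h]
    · simp only [not_not]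
      rintro (h | h | h)
      exacts [⟨I, hI, le_rfl, h⟩, ⟨U, hU, hIU, h⟩, ⟨V, hV, hIV, h⟩]

theorem InV4.exists_hom (hA : InV4 A) {I : Ideal A} (hI : I.IsPrime) :
    ∃ h : CoheytingHom A L5, ∀ a, Rt (h a) ↔ a ∉ I := by
  obtain ⟨U, hIU, hU⟩ := hI.toIsProper.exists_le_maximal
  by_cases hV : ∃ V : Ideal A, V.IsMaximal ∧ I ≤ V ∧ U ≠ V
  · obtain ⟨V, hV, hIV, hUV⟩ := hV
    refine exists_hom_of_ideals hI hU.isPrime hV.isPrime hIU hIV hU hV fun J hJ hIJ => ?_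
    rcases eq_or_lt_of_le hIJ with h | h
    · exact Or.inl h.symm
    · exact Or.inr (hA.eq_or_eq_of_isMaximal hI hU hV (hA.isMaximal_of_lt hI hJ h) hIU hIV hIJ hUV)
  · push Not at hV
    refine exists_hom_of_ideals hI hU.isPrime hU.isPrime hIU hIU hU hU fun J hJ hIJ => ?_
    rcases eq_or_lt_of_le hIJ with h | h
    · exact Or.inl h.symm
    · exact Or.inr (Or.inl (hV J (hA.isMaximal_of_lt hI hJ h) hIJ).symm)

/-- Testing roots suffices: composing with `fstHom` or `sndHom` turns a leaf into a root. -/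
theorem InV4.le_iff (hA : InV4 A) {a b : A} :
    a ≤ b ↔ ∀ h : CoheytingHom A L5, Rt (h a) → Rt (h b) := by
  constructor
  · intro hab h
    rw [← sup_eq_right.2 hab, map_sup, rt_sup]
    exact Or.inl
  · intro H
    by_contra hab
    obtain ⟨I, hI, hbI, haI⟩ := exists_prime_le_notMem (I := Ideal.principal b) (a := a) (by simpa)
    obtain ⟨h, hh⟩ := hA.exists_hom hI
    exact (hh b).1 (H h ((hh a).2 haI)) (hbI (by simp))

theorem InV4.eq_iff (hA : InV4 A) {a b : A} :
    a = b ↔ ∀ h : CoheytingHom A L5, Rt (h a) ↔ Rt (h b) := by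
  rw [le_antisymm_iff, hA.le_iff, hA.le_iff, ← forall_and]
  exact forall_congr' fun h => iff_def.symm

theorem InV4.ne_bot_iff (hA : InV4 A) {a : A} :
    a ≠ ⊥ ↔ ∃ h : CoheytingHom A L5, Rt (h a) := by
  rw [Ne, hA.eq_iff]
  simp

theorem InV4.eq_of_forall_hom (hA : InV4 A) {a b : A} (H : ∀ h : CoheytingHom A L5, h a = h b) :
    a = b := hA.eq_iff.2 fun h => by rw [H h]

end Representation

/-! ### Values of terms and their behaviour under homomorphisms. -/

section Evaluation

variable {A : Type*} [CoheytingAlgebra A] {B : Type*} [CoheytingAlgebra B] {α : Type*}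

/-- The value of a term in a co-Heyting algebra. -/
def ev (t : lang.Term α) (v : α → A) : A := @Term.realize lang A (structureOfCoheyting A) α v t

@[simp] theorem ev_var (i : α) (v : α → A) : ev (Term.var i) v = v i := rfl
@[simp] theorem ev_zero (v : α → A) : ev (0 : lang.Term α) v = ⊥ := rfl
@[simp] theorem ev_one (v : α → A) : ev (1 : lang.Term α) v = ⊤ := rfl
@[simp] theorem ev_sup (s t : lang.Term α) (v : α → A) : ev (s ⊔ t) v = ev s v ⊔ ev t v := rfl
@[simp] theorem ev_inf (s t : lang.Term α) (v : α → A) : ev (s ⊓ t) v = ev s v ⊓ ev t v := rfl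
@[simp] theorem ev_sub (s t : lang.Term α) (v : α → A) : ev (s - t) v = ev s v \ ev t v := rfl

theorem map_ev (h : CoheytingHom A B) (t : lang.Term α) (v : α → A) :
    h (ev t v) = ev t (h ∘ v) := by
  induction t with
  | var i => rfl
  | @func n f ts ih =>
    cases f with
    | zero => exact map_bot h
    | one => exact map_top h
    | sup =>
      change h (ev (ts 0) v ⊔ ev (ts 1) v) = ev (ts 0) (h ∘ v) ⊔ ev (ts 1) (h ∘ v)
      rw [map_sup, ih, ih]
    | inf =>
      change h (ev (ts 0) v ⊓ ev (ts 1) v) = ev (ts 0) (h ∘ v) ⊓ ev (ts 1) (h ∘ v)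
      rw [map_inf, ih, ih]
    | sub =>
      change h (ev (ts 0) v \ ev (ts 1) v) = ev (ts 0) (h ∘ v) \ ev (ts 1) (h ∘ v)
      rw [map_sdiff, ih, ih]

/-- The join of a list of terms. -/
def supT (l : List (lang.Term α)) : lang.Term α := l.foldr (· ⊔ ·) 0
/-- The meet of a list of terms. -/
def infT (l : List (lang.Term α)) : lang.Term α := l.foldr (· ⊓ ·) 1

theorem rt_supT (l : List (lang.Term α)) (e : α → L5) :
    Rt (ev (supT l) e) ↔ ∃ t ∈ l, Rt (ev t e) := by
  induction l with
  | nil => simp [supT]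
  | cons t l ih => simpa [supT] using or_congr_right ih

theorem pt_supT (l : List (lang.Term α)) (e : α → L5) :
    Pt (ev (supT l) e) ↔ ∃ t ∈ l, Pt (ev t e) := by
  induction l with
  | nil => simp [supT]
  | cons t l ih => simpa [supT] using or_congr_right ih

theorem qt_supT (l : List (lang.Term α)) (e : α → L5) :
    Qt (ev (supT l) e) ↔ ∃ t ∈ l, Qt (ev t e) := by
  induction l with
  | nil => simp [supT]
  | cons t l ih => simpa [supT] using or_congr_right ih

theorem rt_infT (l : List (lang.Term α)) (e : α → L5) :
    Rt (ev (infT l) e) ↔ ∀ t ∈ l, Rt (ev t e) := by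
  induction l with
  | nil => simp [infT]
  | cons t l ih => simpa [infT] using fun _ => ih

theorem pt_infT (l : List (lang.Term α)) (e : α → L5) :
    Pt (ev (infT l) e) ↔ ∀ t ∈ l, Pt (ev t e) := by
  induction l with
  | nil => simp [infT]
  | cons t l ih => simpa [infT] using fun _ => ih

theorem qt_infT (l : List (lang.Term α)) (e : α → L5) :
    Qt (ev (infT l) e) ↔ ∀ t ∈ l, Qt (ev t e) := by
  induction l with
  | nil => simp [infT]
  | cons t l ih => simpa [infT] using fun _ => ih

end Evaluation

/-! ### Types over a finite tuple and the terms defining them. -/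

section Types

variable {ι : Type*}

/-- A tuple of elements of `L5` is two-valued if all its entries are `⊥` or `⊤`. -/
def TwoValued (d : ι → L5) : Prop := ∀ i, Rt (d i) → Pt (d i) ∧ Qt (d i)

theorem tuple_ext_iff {d e : ι → L5} :
    d = e ↔ ∀ i, (Rt (d i) ↔ Rt (e i)) ∧ (Pt (d i) ↔ Pt (e i)) ∧ (Qt (d i) ↔ Qt (e i)) := by
  rw [funext_iff]
  exact forall_congr' fun i => L5.ext_iff

theorem twoValued_fst (d : ι → L5) : TwoValued (fstHom ∘ d) := fun i => by simp
theorem twoValued_snd (d : ι → L5) : TwoValued (sndHom ∘ d) := fun i => by simp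

theorem TwoValued.fst_eq {d : ι → L5} (hd : TwoValued d) : fstHom ∘ d = d := by
  rw [tuple_ext_iff]
  intro i
  have := hd i
  have := @Pt.rt (d i)
  have := @Qt.rt (d i)
  simp
  tauto

theorem TwoValued.snd_eq {d : ι → L5} (hd : TwoValued d) : sndHom ∘ d = d := by
  rw [tuple_ext_iff]
  intro i
  have := hd i
  have := @Pt.rt (d i)
  have := @Qt.rt (d i)
  simp
  tauto

theorem TwoValued.swap_eq {d : ι → L5} (hd : TwoValued d) : swapHom ∘ d = d := by
  rw [tuple_ext_iff]
  intro i
  have := hd i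
  have := @Pt.rt (d i)
  have := @Qt.rt (d i)
  simp
  tauto

theorem swap_swap (d : ι → L5) : swapHom ∘ (swapHom ∘ d) = d := by
  rw [tuple_ext_iff]; simp

theorem fst_swap (d : ι → L5) : fstHom ∘ (swapHom ∘ d) = sndHom ∘ d := by
  rw [tuple_ext_iff]; simp

theorem snd_swap (d : ι → L5) : sndHom ∘ (swapHom ∘ d) = fstHom ∘ d := by
  rw [tuple_ext_iff]; simp

theorem twoValued_swap {d : ι → L5} : TwoValued (swapHom ∘ d) ↔ TwoValued d := by
  simp [TwoValued, and_comm]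

theorem eq_of_fst_snd {d e : ι → L5} (hr : ∀ i, Rt (d i) ↔ Rt (e i))
    (hp : fstHom ∘ d = fstHom ∘ e) (hq : sndHom ∘ d = sndHom ∘ e) : d = e := by
  rw [tuple_ext_iff] at *
  intro i
  have h1 := hp i
  have h2 := hq i
  simp at h1 h2
  exact ⟨hr i, h1, h2⟩

theorem swap_eq_self_of_fst_eq_snd {d : ι → L5} (h : fstHom ∘ d = sndHom ∘ d) :
    swapHom ∘ d = d :=
  eq_of_fst_snd (by simp) (by rw [fst_swap, h]) (by rw [snd_swap, h])

/-- `d` is the type of a point of the forest dual to `L5` with respect to `e`. -/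
def PointType (d e : ι → L5) : Prop :=
  d = e ∨ d = swapHom ∘ e ∨ d = fstHom ∘ e ∨ d = sndHom ∘ e

theorem pointType_of_twoValued {d e : ι → L5} (he : TwoValued e) : PointType d e ↔ d = e := by
  simp [PointType, he.fst_eq, he.snd_eq, he.swap_eq]

theorem pointType_of_not_twoValued {d e : ι → L5} (hd : ¬ TwoValued d) :
    PointType d e ↔ d = e ∨ d = swapHom ∘ e := by
  have h1 : d ≠ fstHom ∘ e := fun h => hd (h ▸ twoValued_fst e)
  have h2 : d ≠ sndHom ∘ e := fun h => hd (h ▸ twoValued_snd e)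
  simp [PointType, h1, h2]

variable [Finite ι]

open Classical in
/-- The term defining the closure of the set of maximal points of type `μ`. -/
noncomputable def maxTerm (μ : ι → L5) : lang.Term ι :=
  letI := Fintype.ofFinite ι
  1 - (1 - infT ((Finset.univ : Finset ι).toList.map
    fun i => if Rt (μ i) then Term.var i else 1 - Term.var i))

open Classical in
/-- The term defining the closure of the set of points of type `d`. -/
noncomputable def typeTerm (d : ι → L5) : lang.Term ι :=
  letI := Fintype.ofFinite ι
  (maxTerm (fstHom ∘ d) ⊓ maxTerm (sndHom ∘ d) ⊓
      infT ((Finset.univ.filter fun i => Rt (d i)).toList.map Term.var)) -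
    (supT ((Finset.univ.filter fun μ : ι → L5 => TwoValued μ ∧ μ ≠ fstHom ∘ d ∧
        μ ≠ sndHom ∘ d).toList.map maxTerm) ⊔
      supT ((Finset.univ.filter fun i => ¬ Rt (d i)).toList.map Term.var))

/-- At a leaf `⊤ \ t` is the Boolean complement, so the meet in `maxTerm` tests every coordinate. At
the root it is not, and the double complement discards roots that are not below a leaf passing the
test. -/
theorem pt_maxTerm {μ e : ι → L5} (hμ : TwoValued μ) :
    Pt (ev (maxTerm μ) e) ↔ fstHom ∘ e = μ := by
  have : ∀ i, Pt (ev (if Rt (μ i) then Term.var i else 1 - Term.var i) e) ↔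
      (Pt (e i) ↔ Rt (μ i)) := by
    intro i; split_ifs with h <;> simp [h, -top_sdiff']
  simp only [maxTerm, ev_sub, ev_one, pt_sdiff, pt_infT, List.mem_map, Finset.mem_toList,
    Finset.mem_univ, true_and, forall_exists_index, forall_apply_eq_imp_iff, pt_top, not_not, this]
  rw [tuple_ext_iff]
  refine forall_congr' fun i => ?_
  have := hμ i
  have := @Pt.rt (μ i)
  have := @Qt.rt (μ i)
  simp
  tauto

theorem qt_maxTerm {μ e : ι → L5} (hμ : TwoValued μ) :
    Qt (ev (maxTerm μ) e) ↔ sndHom ∘ e = μ := by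
  rw [← fst_swap, ← pt_maxTerm hμ, ← map_ev, pt_swap]

theorem rt_maxTerm {μ e : ι → L5} (hμ : TwoValued μ) :
    Rt (ev (maxTerm μ) e) ↔ fstHom ∘ e = μ ∨ sndHom ∘ e = μ := by
  rw [← pt_maxTerm hμ, ← qt_maxTerm hμ]
  simp only [maxTerm, ev_sub, ev_one, rt_sdiff, pt_sdiff, qt_sdiff]
  have := @Pt.rt (ev (infT ((@Finset.univ ι (Fintype.ofFinite ι)).toList.map
    fun i => if Rt (μ i) then Term.var i else 1 - Term.var i)) e)
  have := @Qt.rt (ev (infT ((@Finset.univ ι (Fintype.ofFinite ι)).toList.map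
    fun i => if Rt (μ i) then Term.var i else 1 - Term.var i)) e)
  simp only [rt_top, pt_top, qt_top]
  tauto

/-- The meet in `typeTerm d` demands both leaf types of `d` and the entries containing its root; the
subtracted join forbids all other leaf types and entries. The three cases are whether the root or
one of the leaves survives the subtraction. Leaves carry no order, so the type of a root is
determined only up to `swapHom`. -/
theorem rt_typeTerm {d e : ι → L5} : Rt (ev (typeTerm d) e) ↔ PointType d e := by
  have h1 := twoValued_fst d
  have h2 := twoValued_snd d
  simp only [typeTerm, ev_sub, ev_sup, ev_inf, rt_sdiff, rt_sup, pt_sup, qt_sup,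
    rt_inf, pt_inf, qt_inf, rt_supT, pt_supT, qt_supT, rt_infT, pt_infT, qt_infT, List.mem_map,
    Finset.mem_toList, Finset.mem_filter, Finset.mem_univ, true_and, exists_exists_and_eq_and,
    forall_exists_index, and_imp, forall_apply_eq_imp_iff₂, ev_var, rt_maxTerm h1, rt_maxTerm h2,
    pt_maxTerm h1, pt_maxTerm h2, qt_maxTerm h1, qt_maxTerm h2, not_or]
  constructor
  · rintro (⟨⟨⟨h3, h4⟩, h5⟩, h6, h7⟩ | ⟨⟨⟨h3, h4⟩, h5⟩, h6, h7⟩ | ⟨⟨⟨h3, h4⟩, h5⟩, h6, h7⟩)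
    · have h8 : ∀ i, Rt (d i) ↔ Rt (e i) := fun i =>
        ⟨h5 i, fun h => by_contra fun h' => h7 ⟨i, h', h⟩⟩
      have h9 : ∀ μ, TwoValued μ → (fstHom ∘ e = μ ∨ sndHom ∘ e = μ) →
          μ = fstHom ∘ d ∨ μ = sndHom ∘ d := fun μ hμ h => by
        by_contra! hne
        exact h6 ⟨μ, ⟨hμ, hne⟩, (rt_maxTerm hμ).2 h⟩
      -- With `h3` and `h4`, the unordered pairs of leaf types of `d` and `e` coincide.
      have h10 := h9 _ (twoValued_fst e) (Or.inl rfl)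
      have h11 := h9 _ (twoValued_snd e) (Or.inr rfl)
      by_cases h12 : fstHom ∘ d = fstHom ∘ e ∧ sndHom ∘ d = sndHom ∘ e
      · exact Or.inl (eq_of_fst_snd h8 h12.1 h12.2)
      · refine Or.inr (Or.inl (eq_of_fst_snd (by simpa using h8) ?_ ?_))
        · rw [fst_swap]
          grind
        · rw [snd_swap]
          grind
    · refine Or.inr (Or.inr (Or.inl (eq_of_fst_snd (fun i => ?_) ?_ ?_)))
      · simp only [Function.comp, rt_fst]
        exact ⟨h5 i, fun h => by_contra fun h' => h7 ⟨i, h', h⟩⟩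
      · rw [(twoValued_fst e).fst_eq, h3]
      · rw [(twoValued_fst e).snd_eq, h4]
    · refine Or.inr (Or.inr (Or.inr (eq_of_fst_snd (fun i => ?_) ?_ ?_)))
      · simp only [Function.comp, rt_snd]
        exact ⟨h5 i, fun h => by_contra fun h' => h7 ⟨i, h', h⟩⟩
      · rw [(twoValued_snd e).fst_eq, h3]
      · rw [(twoValued_snd e).snd_eq, h4]
  · rintro (h | h | h | h)
    · subst h
      refine Or.inl ⟨⟨⟨Or.inl rfl, Or.inr rfl⟩, fun i h => h⟩, ?_, by simp⟩
      rintro ⟨μ, ⟨hμ, h1, h2⟩, h⟩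
      rw [rt_maxTerm hμ] at h
      tauto
    · subst h
      rw [fst_swap, snd_swap]
      refine Or.inl ⟨⟨⟨Or.inr rfl, Or.inl rfl⟩, fun i => by simp⟩, ?_, by simp⟩
      rintro ⟨μ, ⟨hμ, h1, h2⟩, h⟩
      rw [rt_maxTerm hμ] at h
      tauto
    · subst h
      rw [(twoValued_fst e).fst_eq, (twoValued_fst e).snd_eq]
      refine Or.inr (Or.inl ⟨⟨⟨rfl, rfl⟩, fun i => by simp⟩, ?_, by simp⟩)
      rintro ⟨μ, ⟨hμ, h1, h2⟩, h⟩
      rw [pt_maxTerm hμ] at h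
      exact h1 h.symm
    · subst h
      rw [(twoValued_snd e).fst_eq, (twoValued_snd e).snd_eq]
      refine Or.inr (Or.inr ⟨⟨⟨rfl, rfl⟩, fun i => by simp⟩, ?_, by simp⟩)
      rintro ⟨μ, ⟨hμ, h1, h2⟩, h⟩
      rw [qt_maxTerm hμ] at h
      exact h1 h.symm

theorem pt_typeTerm {d e : ι → L5} : Pt (ev (typeTerm d) e) ↔ d = fstHom ∘ e := by
  rw [← rt_fst, map_ev, rt_typeTerm, pointType_of_twoValued (twoValued_fst e)]

theorem qt_typeTerm {d e : ι → L5} : Qt (ev (typeTerm d) e) ↔ d = sndHom ∘ e := by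
  rw [← rt_snd, map_ev, rt_typeTerm, pointType_of_twoValued (twoValued_snd e)]

open Classical in
/-- The term defining the closure of the set of points with type in `S`. -/
noncomputable def setTerm (S : Set (ι → L5)) : lang.Term ι :=
  letI := Fintype.ofFinite ι
  supT ((Finset.univ.filter (· ∈ S)).toList.map typeTerm)

theorem rt_setTerm {S : Set (ι → L5)} {e : ι → L5} :
    Rt (ev (setTerm S) e) ↔ ∃ d ∈ S, PointType d e := by
  simp [setTerm, rt_supT, rt_typeTerm]

theorem pt_setTerm {S : Set (ι → L5)} {e : ι → L5} :
    Pt (ev (setTerm S) e) ↔ fstHom ∘ e ∈ S := by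
  simp [setTerm, pt_supT, pt_typeTerm]

end Types

/-! ### Similar tuples, and counterparts of elements without maximal points. -/

section Similarity

variable {M N : Type*} [CoheytingAlgebra M] [CoheytingAlgebra N] {ι : Type*}

/-- Two tuples are similar if they have the same images under morphisms to `L5`. -/
def Sim (x : ι → M) (y : ι → N) : Prop :=
  (∀ h : CoheytingHom M L5, ∃ h' : CoheytingHom N L5, h' ∘ y = h ∘ x) ∧
    ∀ h' : CoheytingHom N L5, ∃ h : CoheytingHom M L5, h ∘ x = h' ∘ y

theorem Sim.symm {x : ι → M} {y : ι → N} (h : Sim x y) : Sim y x := ⟨h.2, h.1⟩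

/-- A tuple extended by one element. -/
def cons {A : Type*} (m : A) (x : ι → A) : Option ι → A := fun o => o.elim m x

theorem comp_cons_eq_iff {M N : Type*} {m : M} {x : ι → M} {k : N} {y : ι → N} {f : M → L5}
    {g : N → L5} : g ∘ cons k y = f ∘ cons m x ↔ g ∘ y = f ∘ x ∧ g k = f m := by
  simp [funext_iff, Option.forall, cons, and_comm]

theorem qt_iff_pt_swap (h : CoheytingHom M L5) (m : M) :
    Qt (h m) ↔ Pt ((swapHom.comp h) m) := by simp

theorem pt_iff_rt_fst (h : CoheytingHom M L5) (m : M) :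
    Pt (h m) ↔ Rt ((fstHom.comp h) m) := by simp

theorem qt_iff_rt_snd (h : CoheytingHom M L5) (m : M) :
    Qt (h m) ↔ Rt ((sndHom.comp h) m) := by simp

theorem comp_tuple (f : CoheytingHom L5 L5) (h : CoheytingHom M L5) (x : ι → M) :
    (f.comp h) ∘ x = f ∘ (h ∘ x) := rfl

/-- The density property. -/
def Density (M : Type*) [CoheytingAlgebra M] : Prop :=
  ∀ a : M, a = ⊤ \ (⊤ \ a) → a ≠ ⊥ → ∃ b : M, b ≠ ⊥ ∧ a \ b = a ∧ b ≤ a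

/-- The splitting property. -/
def Splitting (M : Type*) [CoheytingAlgebra M] : Prop :=
  ∀ a b₁ b₂ : M, a \ (b₁ ⊔ b₂) = a → b₁ ⊔ b₂ ≤ a → a ≠ ⊥ → (b₁ ⊓ b₂) ⊓ (⊤ \ a) = ⊥ →
    ∃ a₁ a₂ : M, a₁ ≠ ⊥ ∧ a₂ ≠ ⊥ ∧ a \ a₂ = a₁ ∧ b₁ ≤ a₁ ∧ a \ a₁ = a₂ ∧ b₂ ≤ a₂ ∧
      a₁ ⊓ a₂ = b₁ ⊓ b₂

/-- Splitting read at roots and leaves. The relation `b₁ ⊔ b₂ ≪ a` means that the `bᵢ` contain no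
leaf and that each of their roots is below a leaf in `a`; the condition on `⊤ \ a` means that a root
in both has both leaves in `a`. Second leaves are covered by composing with `swapHom`. -/
theorem Splitting.exists_points (hS : Splitting M) (hM : InV4 M) {a b₁ b₂ : M}
    (ha : ∃ h : CoheytingHom M L5, Rt (h a))
    (hb₁ : ∀ h : CoheytingHom M L5, ¬ Pt (h b₁)) (hb₂ : ∀ h : CoheytingHom M L5, ¬ Pt (h b₂))
    (hb₁a : ∀ h : CoheytingHom M L5, Rt (h b₁) → Pt (h a) ∨ Qt (h a))
    (hb₂a : ∀ h : CoheytingHom M L5, Rt (h b₂) → Pt (h a) ∨ Qt (h a))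
    (hb : ∀ h : CoheytingHom M L5, Rt (h b₁) → Rt (h b₂) → Pt (h a) ∧ Qt (h a)) :
    ∃ a₁ a₂ : M, (∃ h : CoheytingHom M L5, Rt (h a₁)) ∧ (∃ h : CoheytingHom M L5, Rt (h a₂)) ∧
      ∀ h : CoheytingHom M L5,
        (Rt (h a₁) ↔
          (Rt (h a) ∧ ¬ Rt (h a₂)) ∨ (Pt (h a) ∧ ¬ Pt (h a₂)) ∨ (Qt (h a) ∧ ¬ Qt (h a₂))) ∧
        (Rt (h a₂) ↔
          (Rt (h a) ∧ ¬ Rt (h a₁)) ∨ (Pt (h a) ∧ ¬ Pt (h a₁)) ∨ (Qt (h a) ∧ ¬ Qt (h a₁))) ∧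
        (Pt (h a₁) ↔ Pt (h a) ∧ ¬ Pt (h a₂)) ∧ (Qt (h a₁) ↔ Qt (h a) ∧ ¬ Qt (h a₂)) ∧
        (Pt (h a₂) ↔ Pt (h a) ∧ ¬ Pt (h a₁)) ∧ (Qt (h a₂) ↔ Qt (h a) ∧ ¬ Qt (h a₁)) ∧
        (Rt (h b₁) → Rt (h a₁)) ∧ (Rt (h b₂) → Rt (h a₂)) ∧
        (Rt (h a₁) ∧ Rt (h a₂) ↔ Rt (h b₁) ∧ Rt (h b₂)) := by
  have hq₁ : ∀ h : CoheytingHom M L5, ¬ Qt (h b₁) := fun h => by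
    rw [qt_iff_pt_swap]; exact hb₁ _
  have hq₂ : ∀ h : CoheytingHom M L5, ¬ Qt (h b₂) := fun h => by
    rw [qt_iff_pt_swap]; exact hb₂ _
  have hpr : ∀ h : CoheytingHom M L5, Pt (h a) ∨ Qt (h a) → Rt (h a) := fun h h' =>
    h'.elim Pt.rt Qt.rt
  obtain ⟨a₁, a₂, h1, h2, h3, h4, h5, h6, h7⟩ := hS a b₁ b₂
    (by
      rw [hM.eq_iff]
      intro h
      have := hb₁ h
      have := hb₂ h
      have := hq₁ h
      have := hq₂ h
      have := hb₁a h
      have := hb₂a h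
      have := hpr h
      simp only [map_sdiff, map_sup, rt_sdiff, rt_sup, pt_sup, qt_sup]
      tauto)
    (by
      rw [hM.le_iff]
      intro h
      have := hb₁a h
      have := hb₂a h
      have := hpr h
      simp only [map_sup, rt_sup]
      tauto)
    (hM.ne_bot_iff.2 ha)
    (by
      rw [hM.eq_iff]
      intro h
      have := hb h
      have := hpr h
      simp only [map_sdiff, map_inf, rt_sdiff, rt_inf, map_bot, map_top, rt_bot, rt_top, pt_top,
        qt_top]
      tauto)
  refine ⟨a₁, a₂, hM.ne_bot_iff.1 h1, hM.ne_bot_iff.1 h2, fun h => ?_⟩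
  have e1 : h a \ h a₂ = h a₁ := by rw [← map_sdiff, h3]
  have e2 : h a \ h a₁ = h a₂ := by rw [← map_sdiff, h5]
  have e3 : h a₁ ⊓ h a₂ = h b₁ ⊓ h b₂ := by rw [← map_inf, h7, map_inf]
  rw [L5.ext_iff] at e1 e2 e3
  simp only [rt_sdiff, pt_sdiff, qt_sdiff, rt_inf] at e1 e2 e3
  exact ⟨e1.1.symm, e2.1.symm, e1.2.1.symm, e1.2.2.symm, e2.2.1.symm, e2.2.2.symm,
    hM.le_iff.1 h4 h, hM.le_iff.1 h6 h, e3.1⟩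

/-- The regularity `a = ⊤ \ (⊤ \ a)` says that each root in `a` is below a leaf in `a`, and `b ≪ a`
prevents `b` from containing a leaf. -/
theorem Density.exists_points (hD : Density M) (hM : InV4 M) {a : M}
    (ha : ∃ h : CoheytingHom M L5, Rt (h a))
    (hreg : ∀ h : CoheytingHom M L5, Rt (h a) → Pt (h a) ∨ Qt (h a)) :
    ∃ b : M, (∃ h : CoheytingHom M L5, Rt (h b)) ∧ ∀ h : CoheytingHom M L5,
      ¬ Pt (h b) ∧ (Rt (h b) → Rt (h a)) := by
  obtain ⟨b, h1, h2, h3⟩ := hD a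
    (by
      rw [hM.eq_iff]
      intro h
      have := hreg h
      have := @Pt.rt (h a)
      have := @Qt.rt (h a)
      simp only [map_sdiff, map_top, rt_sdiff, pt_sdiff, qt_sdiff, rt_top, pt_top, qt_top]
      tauto)
    (hM.ne_bot_iff.2 ha)
  refine ⟨b, hM.ne_bot_iff.1 h1, fun h => ⟨fun hp => ?_, hM.le_iff.1 h3 h⟩⟩
  have h4 : Pt (h a) := by
    rw [pt_iff_rt_fst] at hp ⊢
    exact hM.le_iff.1 h3 _ hp
  rw [← h2, map_sdiff, pt_sdiff] at h4
  exact h4.2 hp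

/-- All points in `m` have type `d` or its mirror image, and none of them is maximal. -/
structure Located (x : ι → M) (d : ι → L5) (m : M) : Prop where
  not_pt : ∀ h : CoheytingHom M L5, ¬ Pt (h m)
  type_eq : ∀ h : CoheytingHom M L5, Rt (h m) → h ∘ x = d ∨ h ∘ x = swapHom ∘ d
  nonempty : ∃ h : CoheytingHom M L5, Rt (h m)

theorem Located.not_qt {x : ι → M} {d : ι → L5} {m : M} (hm : Located x d m)
    (h : CoheytingHom M L5) : ¬ Qt (h m) := by
  rw [qt_iff_pt_swap]; exact hm.not_pt _

theorem exists_comp_eq_of_eq_or_swap {d : ι → L5} {y : ι → N} {k : N} {e : ι → L5}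
    {r : Prop} (hk : ∃ h : CoheytingHom N L5, (h ∘ y = d ∨ h ∘ y = swapHom ∘ d) ∧ (Rt (h k) ↔ r))
    (he : e = d ∨ e = swapHom ∘ d) :
    ∃ h : CoheytingHom N L5, h ∘ y = e ∧ (Rt (h k) ↔ r) := by
  obtain ⟨h, h1, h2⟩ := hk
  by_cases h3 : h ∘ y = e
  · exact ⟨h, h3, h2⟩
  · refine ⟨swapHom.comp h, ?_, by simpa using h2⟩
    rw [comp_tuple]
    rcases h1 with h1 | h1 <;> rcases he with rfl | rfl <;> simp_all [swap_swap]

/-- Adjoining `m` only divides the type `d`, with its mirror image, into points inside and outside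
`m`. Inside points exist by `nonempty`, so just the outside ones need a hypothesis, `hfree`. -/
theorem Located.exists_comp_cons_eq {x : ι → M} {y : ι → N} {d : ι → L5} {m : M} {k : N}
    (hm : Located x d m) (hk : Located y d k)
    (hxy : ∀ h : CoheytingHom M L5, ∃ h' : CoheytingHom N L5, h' ∘ y = h ∘ x)
    (hfree : (∃ h : CoheytingHom M L5, h ∘ x = d ∧ ¬ Rt (h m)) →
      ∃ h' : CoheytingHom N L5, h' ∘ y = d ∧ ¬ Rt (h' k)) (h : CoheytingHom M L5) :
    ∃ h' : CoheytingHom N L5, h' ∘ cons k y = h ∘ cons m x := by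
  suffices H : ∃ h' : CoheytingHom N L5, h' ∘ y = h ∘ x ∧ (Rt (h' k) ↔ Rt (h m)) by
    obtain ⟨h', h1, h2⟩ := H
    refine ⟨h', comp_cons_eq_iff.2 ⟨h1, ?_⟩⟩
    rw [L5.ext_iff]
    simp [h2, hm.not_pt, hm.not_qt, hk.not_pt, hk.not_qt]
  by_cases hd : h ∘ x = d ∨ h ∘ x = swapHom ∘ d
  · by_cases hr : Rt (h m)
    · obtain ⟨h0, h0k⟩ := hk.nonempty
      exact exists_comp_eq_of_eq_or_swap ⟨h0, hk.type_eq _ h0k, by simp [h0k, hr]⟩ hd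
    · obtain ⟨h1, h2, h3⟩ : ∃ h1 : CoheytingHom M L5, h1 ∘ x = d ∧ (Rt (h1 m) ↔ False) :=
        exists_comp_eq_of_eq_or_swap ⟨h, hd, by simp [hr]⟩ (Or.inl rfl)
      obtain ⟨h', h4, h5⟩ := hfree ⟨h1, h2, by simp [h3]⟩
      exact exists_comp_eq_of_eq_or_swap ⟨h', Or.inl h4, by simp [h5, hr]⟩ hd
  · obtain ⟨h', h1⟩ := hxy h
    have h2 : ¬ Rt (h m) := fun h2 => hd (hm.type_eq h h2)
    have h3 : ¬ Rt (h' k) := fun h3 => hd (h1 ▸ hk.type_eq h' h3)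
    exact ⟨h', h1, by simp [h2, h3]⟩

variable [Finite ι]

/-- The closure of the set of points whose type with respect to `x` is `d`. -/
noncomputable def typeElt (d : ι → L5) (x : ι → M) : M := ev (typeTerm d) x

theorem rt_typeElt {d : ι → L5} {x : ι → M} {h : CoheytingHom M L5} :
    Rt (h (typeElt d x)) ↔ PointType d (h ∘ x) := by
  rw [typeElt, map_ev, rt_typeTerm]

theorem pt_typeElt {d : ι → L5} {x : ι → M} {h : CoheytingHom M L5} :
    Pt (h (typeElt d x)) ↔ d = fstHom ∘ (h ∘ x) := by
  rw [typeElt, map_ev, pt_typeTerm]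

theorem qt_typeElt {d : ι → L5} {x : ι → M} {h : CoheytingHom M L5} :
    Qt (h (typeElt d x)) ↔ d = sndHom ∘ (h ∘ x) := by
  rw [typeElt, map_ev, qt_typeTerm]

theorem rt_typeElt_of_not_twoValued {d : ι → L5} {x : ι → M} {h : CoheytingHom M L5}
    (hd : ¬ TwoValued d) :
    Rt (h (typeElt d x)) ↔ h ∘ x = d ∨ h ∘ x = swapHom ∘ d := by
  rw [rt_typeElt, pointType_of_not_twoValued hd]
  refine or_congr eq_comm ⟨fun h => ?_, fun h => ?_⟩ <;> rw [h, swap_swap]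

theorem not_pt_typeElt {d : ι → L5} {x : ι → M} {h : CoheytingHom M L5} (hd : ¬ TwoValued d) :
    ¬ Pt (h (typeElt d x)) := fun h' => by
  rw [pt_typeElt] at h'
  exact hd (h' ▸ twoValued_fst _)

/-- The leaves above a point of two-valued type have that type too, so the element is the closure of
its maximal points. -/
theorem rt_typeElt_iff_of_twoValued {d : ι → L5} {x : ι → M} {h : CoheytingHom M L5}
    (hd : TwoValued d) :
    Rt (h (typeElt d x)) ↔ Pt (h (typeElt d x)) ∨ Qt (h (typeElt d x)) := by
  refine ⟨fun h' => ?_, fun h' => h'.elim Pt.rt Qt.rt⟩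
  rw [pt_typeElt, qt_typeElt]
  rcases rt_typeElt.1 h' with h' | h' | h' | h'
  · left; rw [← h', hd.fst_eq]
  · left; rw [← swap_swap (h ∘ x), ← h', hd.swap_eq, hd.fst_eq]
  · exact Or.inl h'
  · exact Or.inr h'

/-- Splitting `typeElt d x` over `b₁ = b₂ = ⊥` gives two disjoint nonzero parts, and one part leaves
points of type `d` outside. The whole element leaves none. The proposition `r` lets the choice
imitate the other algebra. -/
theorem exists_located_of_not_twoValued (hM : InV4 M) (hS : Splitting M) {x : ι → M}
    {d : ι → L5} (hd : ¬ TwoValued d) (hx : ∃ h : CoheytingHom M L5, h ∘ x = d) (r : Prop) :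
    ∃ m : M, Located x d m ∧ ((∃ h : CoheytingHom M L5, h ∘ x = d ∧ ¬ Rt (h m)) ↔ r) := by
  have ha : ∃ h : CoheytingHom M L5, Rt (h (typeElt d x)) := by
    obtain ⟨h, hh⟩ := hx
    exact ⟨h, (rt_typeElt_of_not_twoValued hd).2 (Or.inl hh)⟩
  by_cases hr : r
  · obtain ⟨a₁, a₂, h1, h2, H⟩ := hS.exists_points hM (a := typeElt d x) (b₁ := ⊥) (b₂ := ⊥) ha
      (by simp) (by simp) (by simp) (by simp) (by simp)
    refine ⟨a₁, ⟨fun h hp => not_pt_typeElt (h := h) hd ((H h).2.2.1.1 hp).1, fun h hr => ?_, h1⟩,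
      iff_of_true ?_ hr⟩
    · obtain ⟨h3, h4, h5⟩ := H h
      rw [← rt_typeElt_of_not_twoValued hd]
      have := @Pt.rt (h (typeElt d x))
      have := @Qt.rt (h (typeElt d x))
      tauto
    · obtain ⟨h, hh⟩ := h2
      obtain ⟨h3, h4, -, -, -, -, -, -, h5⟩ := H h
      have h6 : Rt (h (typeElt d x)) := by
        have := @Pt.rt (h (typeElt d x))
        have := @Qt.rt (h (typeElt d x))
        tauto
      have h7 : ¬ Rt (h a₁) := by simpa [hh] using h5
      obtain ⟨h', h8, h9⟩ := exists_comp_eq_of_eq_or_swap (r := False)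
        ⟨h, (rt_typeElt_of_not_twoValued hd).1 h6, by simpa using h7⟩ (Or.inl rfl)
      exact ⟨h', h8, by simp [h9]⟩
  · refine ⟨typeElt d x, ⟨fun h => not_pt_typeElt hd,
      fun h => (rt_typeElt_of_not_twoValued hd).1, ha⟩, iff_of_false ?_ hr⟩
    rintro ⟨h, h1, h2⟩
    exact h2 ((rt_typeElt_of_not_twoValued hd).2 (Or.inl h1))

/-- Here density must supply nonmaximal points of type `d`. The element `B` collects the points of
`typeElt d x` whose type is not two-valued. Splitting puts `B` into `a₁` and leaves a disjoint
regular `a₂`; any point of some `b ≪ a₂` then has type `d`. -/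
theorem exists_located_of_twoValued (hM : InV4 M) (hS : Splitting M) (hD : Density M) {x : ι → M}
    {d : ι → L5} (hd : TwoValued d) (hx : ∃ h : CoheytingHom M L5, h ∘ x = d) :
    ∃ m : M, Located x d m := by
  have hreg : ∀ h : CoheytingHom M L5, Rt (h (typeElt d x)) ↔ _ := fun h =>
    rt_typeElt_iff_of_twoValued hd
  let B : M := ev (setTerm {e : ι → L5 | ¬ TwoValued e}) x ⊓ typeElt d x
  have hB : ∀ h : CoheytingHom M L5, Rt (h B) ↔ ¬ TwoValued (h ∘ x) ∧ Rt (h (typeElt d x)) := by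
    intro h
    rw [map_inf, rt_inf, map_ev, rt_setTerm]
    refine and_congr_left fun _ => ⟨?_, fun h' => ⟨_, h', Or.inl rfl⟩⟩
    rintro ⟨e, he, he'⟩
    rw [pointType_of_not_twoValued he] at he'
    rcases he' with rfl | rfl
    · exact he
    · exact fun h' => he (twoValued_swap.2 h')
  have hBp : ∀ h : CoheytingHom M L5, ¬ Pt (h B) := by
    intro h
    rw [pt_iff_rt_fst, hB, comp_tuple]
    exact fun h' => h'.1 (twoValued_fst _)
  obtain ⟨a₁, a₂, h1, h2, H⟩ := hS.exists_points hM (a := typeElt d x) (b₁ := B) (b₂ := ⊥)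
      (by
        obtain ⟨h, hh⟩ := hx
        exact ⟨h, rt_typeElt.2 (Or.inl hh.symm)⟩)
      hBp (by simp) (fun h h' => (hreg h).1 ((hB h).1 h').2) (by simp) (by simp)
  obtain ⟨b, h3, h4⟩ := hD.exists_points hM h2 fun h h' => by
    obtain ⟨g1, g2, g3, g4, g5, g6, g7, g8, g9⟩ := H h
    have := hreg h
    have := @Pt.rt (h a₁)
    have := @Qt.rt (h a₁)
    clear g1 g3 g4 g7 g8 g9
    grind
  refine ⟨b, fun h => (h4 h).1, fun h h' => ?_, h3⟩
  obtain ⟨g1, g2, g3, g4, g5, g6, g7, g8, g9⟩ := H h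
  have g10 := (h4 h).2 h'
  have g11 : Rt (h (typeElt d x)) := by
    have := @Pt.rt (h (typeElt d x))
    have := @Qt.rt (h (typeElt d x))
    clear g1 g3 g4 g5 g6 g7 g8 g9
    grind
  have g12 : TwoValued (h ∘ x) := by
    by_contra g12
    have := g7 ((hB h).2 ⟨g12, g11⟩)
    simp [this, g10] at g9
  rw [rt_typeElt, pointType_of_twoValued g12] at g11
  exact Or.inl g11.symm

/-- A tuple similar to a tuple `y` can be extended by a counterpart of an element `k` that contains
no maximal points and whose points all have the same type. -/
theorem Sim.exists_cons_of_not_pt (hM : InV4 M) (hS : Splitting M) (hD : Density M) {x : ι → M}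
    {y : ι → N} (hxy : Sim x y) {k : N} (hk : ∀ h : CoheytingHom N L5, ¬ Pt (h k))
    (hk' : ∀ h h' : CoheytingHom N L5, Rt (h k) → Rt (h' k) →
      h ∘ y = h' ∘ y ∨ h ∘ y = swapHom ∘ (h' ∘ y)) :
    ∃ m : M, Sim (cons m x) (cons k y) := by
  by_cases hne : ∃ h : CoheytingHom N L5, Rt (h k)
  · obtain ⟨h0, hh0⟩ := hne
    have hky : Located y (h0 ∘ y) k := ⟨hk, fun h h' => hk' h h0 h' hh0, h0, hh0⟩
    obtain ⟨m, hm, hmk⟩ : ∃ m : M, Located x (h0 ∘ y) m ∧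
        ((∃ h : CoheytingHom M L5, h ∘ x = h0 ∘ y ∧ ¬ Rt (h m)) ↔
          ∃ h' : CoheytingHom N L5, h' ∘ y = h0 ∘ y ∧ ¬ Rt (h' k)) := by
      by_cases hd : TwoValued (h0 ∘ y)
      · obtain ⟨m, hm⟩ := exists_located_of_twoValued hM hS hD hd (hxy.2 h0)
        -- A leaf above a point of two-valued type `d` has type `d` and avoids any element without
        -- maximal points, so outside points exist in both algebras.
        refine ⟨m, hm, iff_of_true ?_ ?_⟩
        · obtain ⟨h, hh⟩ := hxy.2 h0
          refine ⟨fstHom.comp h, by rw [comp_tuple, hh, hd.fst_eq], ?_⟩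
          simpa using hm.not_pt h
        · exact ⟨fstHom.comp h0, by rw [comp_tuple, hd.fst_eq], by simpa using hk h0⟩
      · exact exists_located_of_not_twoValued hM hS hd (hxy.2 h0) _
    exact ⟨m, hm.exists_comp_cons_eq hky hxy.1 hmk.1, hky.exists_comp_cons_eq hm hxy.2 hmk.2⟩
  · push Not at hne
    have hkb : ∀ h : CoheytingHom N L5, h k = ⊥ := fun h => by simpa [Rt] using hne h
    refine ⟨⊥, fun h => ?_, fun h => ?_⟩
    · obtain ⟨h', hh⟩ := hxy.1 h
      exact ⟨h', comp_cons_eq_iff.2 ⟨hh, by rw [hkb, map_bot]⟩⟩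
    · obtain ⟨h', hh⟩ := hxy.2 h
      exact ⟨h', comp_cons_eq_iff.2 ⟨hh, by rw [hkb, map_bot]⟩⟩

end Similarity

/-! ### Counterparts of closures of sets of maximal points. -/

section MaximalStep

variable {M N : Type*} [CoheytingAlgebra M] [CoheytingAlgebra N] {ι : Type*}

theorem rt_setTerm_of_not_twoValued [Finite ι] {S : Set (ι → L5)} (hS : ∀ d ∈ S, ¬ TwoValued d)
    (hS' : ∀ d ∈ S, swapHom ∘ d ∈ S) {e : ι → L5} : Rt (ev (setTerm S) e) ↔ e ∈ S := by
  rw [rt_setTerm]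
  refine ⟨?_, fun h => ⟨e, h, Or.inl rfl⟩⟩
  rintro ⟨d, hd, hde⟩
  rw [pointType_of_not_twoValued (hS d hd)] at hde
  rcases hde with rfl | rfl
  · exact hd
  · rw [← swap_swap e]
    exact hS' _ hd

theorem sim_cons_of_forall {x : ι → M} {y : ι → N} {m : M} {g : N}
    (h₁ : ∀ h : CoheytingHom M L5, ∃ h' : CoheytingHom N L5, h' ∘ y = h ∘ x ∧ h' g = h m)
    (h₂ : ∀ h' : CoheytingHom N L5, ∃ h : CoheytingHom M L5, h ∘ x = h' ∘ y ∧ h m = h' g) :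
    Sim (cons m x) (cons g y) :=
  ⟨fun h => (h₁ h).imp fun _ => comp_cons_eq_iff.2, fun h => (h₂ h).imp fun _ => comp_cons_eq_iff.2⟩

theorem Sim.cons_ev {x : ι → M} {y : ι → N} (hxy : Sim x y) (t : lang.Term ι) :
    Sim (cons (ev t x) x) (cons (ev t y) y) := by
  refine sim_cons_of_forall (fun h => ?_) fun h => ?_
  · obtain ⟨h', hh⟩ := hxy.1 h
    exact ⟨h', hh, by rw [map_ev, map_ev, hh]⟩
  · obtain ⟨h', hh⟩ := hxy.2 h
    exact ⟨h', hh, by rw [map_ev, map_ev, hh]⟩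

/-- The element `g` is the closure of a set of maximal points of type `μ` with respect to `y`, and
the types of points that are not two-valued determine their position with respect to `g`. -/
structure MaxLocated (y : ι → N) (μ : ι → L5) (g : N) : Prop where
  regular : ∀ h : CoheytingHom N L5, Rt (h g) → Pt (h g) ∨ Qt (h g)
  fst_eq : ∀ h : CoheytingHom N L5, Pt (h g) → fstHom ∘ (h ∘ y) = μ
  eq_or_swap : ∀ h h' : CoheytingHom N L5, h ∘ y = h' ∘ y → ¬ TwoValued (h ∘ y) →
    h g = h' g ∨ h g = swapHom (h' g) ∧ swapHom ∘ (h ∘ y) = h ∘ y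
  twoValued : ∀ h : CoheytingHom N L5, TwoValued (h ∘ y) → Rt (h g) → Pt (h g) ∧ Qt (h g)

namespace MaxLocated

variable {y : ι → N} {μ : ι → L5} {g : N}

theorem snd_eq (hg : MaxLocated y μ g) (h : CoheytingHom N L5) (hq : Qt (h g)) :
    sndHom ∘ (h ∘ y) = μ := by
  rw [qt_iff_pt_swap] at hq
  have := hg.fst_eq _ hq
  rwa [comp_tuple, fst_swap] at this

/-- The types of the nonmaximal points below a maximal point in `g`. -/
def insideTypes (y : ι → N) (g : N) : Set (ι → L5) :=
  {d | ¬ TwoValued d ∧ ∃ h : CoheytingHom N L5, h ∘ y = d ∧ Rt (h g)}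

/-- The types of the nonmaximal points below a maximal point of type `μ` outside `g`. -/
def outsideTypes (y : ι → N) (μ : ι → L5) (g : N) : Set (ι → L5) :=
  {d | ¬ TwoValued d ∧ ∃ h : CoheytingHom N L5, h ∘ y = d ∧
    (fstHom ∘ d = μ ∧ ¬ Pt (h g) ∨ sndHom ∘ d = μ ∧ ¬ Qt (h g))}

theorem swap_mem_insideTypes (d : ι → L5) (hd : d ∈ insideTypes y g) :
    swapHom ∘ d ∈ insideTypes y g := by
  obtain ⟨h1, h, h2, h3⟩ := hd
  exact ⟨fun h' => h1 (twoValued_swap.1 h'), swapHom.comp h, by rw [comp_tuple, h2], by simpa⟩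

theorem swap_mem_outsideTypes (d : ι → L5) (hd : d ∈ outsideTypes y μ g) :
    swapHom ∘ d ∈ outsideTypes y μ g := by
  obtain ⟨h1, h, h2, h3⟩ := hd
  refine ⟨fun h' => h1 (twoValued_swap.1 h'), swapHom.comp h, by rw [comp_tuple, h2], ?_⟩
  rw [fst_swap, snd_swap]
  simpa using h3.symm

/-- By `eq_or_swap`, points of the same type agree about their leaves in `g` up to an exchange, so
the choice of witness is immaterial. -/
theorem mem_insideTypes (hg : MaxLocated y μ g) {h : CoheytingHom N L5}
    (hd : ¬ TwoValued (h ∘ y)) : h ∘ y ∈ insideTypes y g ↔ Pt (h g) ∨ Qt (h g) := by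
  constructor
  · rintro ⟨-, h', h1, h2⟩
    refine hg.regular h ?_
    rcases hg.eq_or_swap h h' h1.symm hd with h3 | ⟨h3, -⟩ <;> rw [h3] <;> simpa using h2
  · exact fun h' => ⟨hd, h, rfl, h'.elim Pt.rt Qt.rt⟩

theorem mem_outsideTypes (hg : MaxLocated y μ g) {h : CoheytingHom N L5}
    (hd : ¬ TwoValued (h ∘ y)) : h ∘ y ∈ outsideTypes y μ g ↔
      (fstHom ∘ (h ∘ y) = μ ∧ ¬ Pt (h g) ∨ sndHom ∘ (h ∘ y) = μ ∧ ¬ Qt (h g)) := by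
  constructor
  · rintro ⟨-, h', h1, h2⟩
    rcases hg.eq_or_swap h h' h1.symm hd with h3 | ⟨h3, h4⟩
    · rwa [h3]
    · have h5 : fstHom ∘ (h ∘ y) = sndHom ∘ (h ∘ y) := by rw [← fst_swap, h4]
      rw [h3, pt_swap, qt_swap]
      rw [h5] at h2 ⊢
      exact h2.symm
  · exact fun h' => ⟨hd, h, rfl, h'⟩

end MaxLocated

/-- A tuple similar to a tuple `y` can be extended by a counterpart of the closure of a set of
maximal points of the same type. -/
theorem Sim.exists_cons_of_maxLocated [Finite ι] (hM : InV4 M) (hS : Splitting M) {x : ι → M}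
    {y : ι → N} (hxy : Sim x y) {g : N} {μ : ι → L5} (hμ : TwoValued μ) (hg : MaxLocated y μ g)
    (h₁ : ∃ h : CoheytingHom N L5, h ∘ y = μ ∧ Rt (h g))
    (h₀ : ∃ h : CoheytingHom N L5, h ∘ y = μ ∧ ¬ Rt (h g)) :
    ∃ m : M, Sim (cons m x) (cons g y) := by
  -- The elements `b₁` and `b₂` prescribe the nonmaximal points to be put below the copy `a₁` of `g`
  -- and below the rest `a₂`. A type in both sees one leaf in `g` and another of type `μ` outside,
  -- so both leaves have type `μ`, as splitting requires.
  let b₁ : M := ev (setTerm (MaxLocated.insideTypes y g)) x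
  let b₂ : M := ev (setTerm (MaxLocated.outsideTypes y μ g)) x
  have hb₁ : ∀ h : CoheytingHom M L5, Rt (h b₁) ↔ h ∘ x ∈ MaxLocated.insideTypes y g := fun h => by
    rw [map_ev, rt_setTerm_of_not_twoValued (fun d hd => hd.1) MaxLocated.swap_mem_insideTypes]
  have hb₂ : ∀ h : CoheytingHom M L5, Rt (h b₂) ↔ h ∘ x ∈ MaxLocated.outsideTypes y μ g :=
    fun h => by
      rw [map_ev, rt_setTerm_of_not_twoValued (fun d hd => hd.1) MaxLocated.swap_mem_outsideTypes]
  have hp₁ : ∀ h : CoheytingHom M L5, ¬ Pt (h b₁) := fun h h' => by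
    rw [map_ev, pt_setTerm] at h'
    exact h'.1 (twoValued_fst _)
  have hp₂ : ∀ h : CoheytingHom M L5, ¬ Pt (h b₂) := fun h h' => by
    rw [map_ev, pt_setTerm] at h'
    exact h'.1 (twoValued_fst _)
  have ha : ∀ h : CoheytingHom M L5,
      (Rt (h (typeElt μ x)) ↔ Pt (h (typeElt μ x)) ∨ Qt (h (typeElt μ x))) ∧
      (Pt (h (typeElt μ x)) ↔ fstHom ∘ (h ∘ x) = μ) ∧
      (Qt (h (typeElt μ x)) ↔ sndHom ∘ (h ∘ x) = μ) := fun h =>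
    ⟨rt_typeElt_iff_of_twoValued hμ, by rw [pt_typeElt, eq_comm], by rw [qt_typeElt, eq_comm]⟩
  have hbits : ∀ h : CoheytingHom M L5, ∀ h' : CoheytingHom N L5, h' ∘ y = h ∘ x →
      ¬ TwoValued (h ∘ x) → (Rt (h b₁) ↔ Pt (h' g) ∨ Qt (h' g)) ∧
        (Rt (h b₂) ↔ Pt (h (typeElt μ x)) ∧ ¬ Pt (h' g) ∨ Qt (h (typeElt μ x)) ∧ ¬ Qt (h' g)) ∧
        (Pt (h' g) → Pt (h (typeElt μ x))) ∧ (Qt (h' g) → Qt (h (typeElt μ x))) := by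
    intro h h' hh hd
    rw [hb₁, hb₂, (ha h).2.1, (ha h).2.2, ← hh]
    rw [← hh] at hd
    exact ⟨hg.mem_insideTypes hd, hg.mem_outsideTypes hd, hg.fst_eq h', hg.snd_eq h'⟩
  obtain ⟨a₁, a₂, ha₁, ha₂, H⟩ := hS.exists_points hM (a := typeElt μ x) (b₁ := b₁) (b₂ := b₂)
      (by
        obtain ⟨h, hh, -⟩ := h₁
        obtain ⟨h', hh'⟩ := hxy.2 h
        exact ⟨h', rt_typeElt.2 (Or.inl (by rw [hh', hh]))⟩)
      hp₁ hp₂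
      (fun h hr => by
        obtain ⟨h', hh⟩ := hxy.1 h
        have := hbits h h' hh ((hb₁ h).1 hr).1
        tauto)
      (fun h hr => by
        obtain ⟨h', hh⟩ := hxy.1 h
        have := hbits h h' hh ((hb₂ h).1 hr).1
        tauto)
      (fun h hr _ => by
        obtain ⟨h', hh⟩ := hxy.1 h
        have := hbits h h' hh ((hb₁ h).1 hr).1
        tauto)
  -- By `a₁ ⊓ a₂ = b₁ ⊓ b₂`, a point meets both parts only if its counterpart does. Which of its
  -- leaves lies in `a₁` is then left open, but both have type `μ` and the type is symmetric.
  have key : ∀ h : CoheytingHom M L5, ∀ h' : CoheytingHom N L5, h' ∘ y = h ∘ x →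
      ¬ TwoValued (h ∘ x) →
        h a₁ = h' g ∨ h a₁ = swapHom (h' g) ∧ swapHom ∘ (h ∘ x) = h ∘ x := by
    intro h h' hh hd
    obtain ⟨f1, f2, f3, f4⟩ := hbits h h' hh hd
    obtain ⟨e1, e2, e3⟩ := ha h
    obtain ⟨g1, g2, g3, g4, g5, g6, g7, g8, g9⟩ := H h
    have hr := hg.regular h'
    have hr1 := @Pt.rt (h' g)
    have hr2 := @Qt.rt (h' g)
    have hr3 := @Pt.rt (h a₁)
    have hr4 := @Qt.rt (h a₁)
    have hr5 := @Pt.rt (h a₂)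
    have hr6 := @Qt.rt (h a₂)
    have hs : Pt (h (typeElt μ x)) → Qt (h (typeElt μ x)) → swapHom ∘ (h ∘ x) = h ∘ x := by
      rw [e2, e3]
      exact fun h1 h2 => swap_eq_self_of_fst_eq_snd (by rw [h1, h2])
    rw [L5.ext_iff, L5.ext_iff, rt_swap, pt_swap, qt_swap]
    clear e2 e3 hbits H ha hb₁ hb₂ hp₁ hp₂
    grind
  -- A point of two-valued type is outside `b₁`, hence not in both parts; if it lies in `a₁`, so do
  -- both its leaves.
  have key₂ : ∀ h : CoheytingHom M L5, TwoValued (h ∘ x) →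
      (Rt (h a₁) → h ∘ x = μ ∧ h a₁ = ⊤) ∧ (h ∘ x = μ → (Rt (h a₁) ↔ ¬ Rt (h a₂))) := by
    intro h hd
    have n1 : ¬ Rt (h b₁) := fun h' => ((hb₁ h).1 h').1 hd
    obtain ⟨e1, e2, e3⟩ := ha h
    rw [hd.fst_eq] at e2
    rw [hd.snd_eq] at e3
    obtain ⟨g1, g2, g3, g4, g5, g6, g7, g8, g9⟩ := H h
    have hr3 := @Pt.rt (h a₁)
    have hr4 := @Qt.rt (h a₁)
    have hr5 := @Pt.rt (h a₂)
    have hr6 := @Qt.rt (h a₂)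
    rw [L5.ext_iff]
    simp only [rt_top, pt_top, qt_top, iff_true]
    clear hbits H ha hb₁ hb₂ hp₁ hp₂
    grind
  have hmax : ∀ h : CoheytingHom M L5, TwoValued (h ∘ x) → h ∘ x ≠ μ → h a₁ = ⊥ := fun h hd hne => by
    have : ¬ Rt (h a₁) := fun h' => hne ((key₂ h hd).1 h').1
    simpa [Rt] using this
  have hgmax : ∀ h : CoheytingHom N L5, TwoValued (h ∘ y) → h ∘ y ≠ μ → h g = ⊥ := fun h hd hne => by
    have : ¬ Rt (h g) := fun h' => hne (by
      rw [← hd.fst_eq]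
      exact hg.fst_eq h (hg.twoValued h hd h').1)
    simpa [Rt] using this
  have hgtop : ∀ h : CoheytingHom N L5, TwoValued (h ∘ y) → Rt (h g) → h g = ⊤ := fun h hd h' => by
    have := hg.twoValued h hd h'
    rw [L5.ext_iff]
    simp [this, h']
  obtain ⟨k1, hk1, hk1'⟩ := h₁
  obtain ⟨k0, hk0, hk0'⟩ := h₀
  -- Applied to `a₁` and `a₂`, this provides the counterparts of `k1` and `k0`: a nonzero regular
  -- part contains a leaf, necessarily of type `μ`.
  have hpq : ∀ a : M, (∃ h : CoheytingHom M L5, Rt (h a)) →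
      (∀ h : CoheytingHom M L5, Rt (h a) → Pt (h a) ∨ Qt (h a)) →
      (∀ h : CoheytingHom M L5, Pt (h a) → fstHom ∘ (h ∘ x) = μ) →
      (∀ h : CoheytingHom M L5, Qt (h a) → sndHom ∘ (h ∘ x) = μ) →
      ∃ h : CoheytingHom M L5, h ∘ x = μ ∧ Rt (h a) := by
    rintro a ⟨h, hh⟩ hr hp hq
    rcases hr h hh with h' | h'
    · exact ⟨fstHom.comp h, hp h h', by simpa⟩
    · exact ⟨sndHom.comp h, hq h h', by simpa⟩
  obtain ⟨j1, hj1, hj1'⟩ := hpq a₁ ha₁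
    (fun h => by
      obtain ⟨g1, g2, g3, g4, g5, g6, g7, g8, g9⟩ := H h
      have := (ha h).1
      have hr5 := @Pt.rt (h a₂)
      have hr6 := @Qt.rt (h a₂)
      clear hbits H ha hb₁ hb₂ hp₁ hp₂ key key₂ hmax hgmax hgtop hpq g7 g8 g9 g2
      grind)
    (fun h h' => (ha h).2.1.1 ((H h).2.2.1.1 h').1) (fun h h' => (ha h).2.2.1 ((H h).2.2.2.1.1 h').1)
  obtain ⟨j0, hj0, hj0'⟩ := hpq a₂ ha₂
    (fun h => by
      obtain ⟨g1, g2, g3, g4, g5, g6, g7, g8, g9⟩ := H h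
      have := (ha h).1
      have hr5 := @Pt.rt (h a₁)
      have hr6 := @Qt.rt (h a₁)
      clear hbits H ha hb₁ hb₂ hp₁ hp₂ key key₂ hmax hgmax hgtop hpq g7 g8 g9 g1
      grind)
    (fun h h' => (ha h).2.1.1 ((H h).2.2.2.2.1.1 h').1)
    (fun h h' => (ha h).2.2.1 ((H h).2.2.2.2.2.1.1 h').1)
  have hbot : ∀ t : L5, ¬ Rt t → t = ⊥ := fun t ht => by simpa [Rt] using ht
  refine ⟨a₁, sim_cons_of_forall (fun h => ?_) fun h' => ?_⟩
  · by_cases hd : TwoValued (h ∘ x)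
    · by_cases he : h ∘ x = μ
      · by_cases hr : Rt (h a₁)
        · refine ⟨k1, by rw [hk1, he], ?_⟩
          rw [((key₂ h hd).1 hr).2]
          exact hgtop k1 (by rwa [hk1]) hk1'
        · exact ⟨k0, by rw [hk0, he], by rw [hbot _ hr, hbot _ hk0']⟩
      · obtain ⟨h', hh⟩ := hxy.1 h
        refine ⟨h', hh, ?_⟩
        rw [hmax h hd he]
        rw [← hh] at hd he
        exact hgmax h' hd he
    · obtain ⟨h', hh⟩ := hxy.1 h
      rcases key h h' hh hd with h1 | ⟨h1, h2⟩
      · exact ⟨h', hh, h1.symm⟩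
      · exact ⟨swapHom.comp h', by rw [comp_tuple, hh, h2], h1.symm⟩
  · by_cases hd : TwoValued (h' ∘ y)
    · by_cases he : h' ∘ y = μ
      · by_cases hr : Rt (h' g)
        · refine ⟨j1, by rw [hj1, he], ?_⟩
          rw [((key₂ j1 (by rwa [hj1])).1 hj1').2, hgtop h' hd hr]
        · refine ⟨j0, by rw [hj0, he], ?_⟩
          rw [hbot _ hr]
          exact hbot _ fun h1 => ((key₂ j0 (by rwa [hj0])).2 hj0).1 h1 hj0'
      · obtain ⟨h, hh⟩ := hxy.2 h'
        refine ⟨h, hh, ?_⟩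
        rw [hgmax h' hd he]
        rw [← hh] at hd he
        exact hmax h hd he
    · obtain ⟨h, hh⟩ := hxy.2 h'
      rcases key h h' hh.symm (by rwa [hh]) with h1 | ⟨h1, h2⟩
      · exact ⟨h, hh, h1⟩
      · refine ⟨swapHom.comp h, by rw [comp_tuple, h2, hh], ?_⟩
        change swapHom (h a₁) = _
        rw [h1, L5.ext_iff]
        simp

end MaximalStep

/-! ### The one-element extension theorem. -/

section Extension

universe v

variable {M N : Type*} [CoheytingAlgebra M] [CoheytingAlgebra N]

theorem Sim.comp {ι κ : Type*} {x : ι → M} {y : ι → N} (hxy : Sim x y) (f : κ → ι) :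
    Sim (x ∘ f) (y ∘ f) :=
  ⟨fun h => (hxy.1 h).imp fun h' hh => by rw [← Function.comp_assoc, hh, Function.comp_assoc],
    fun h => (hxy.2 h).imp fun h' hh => by rw [← Function.comp_assoc, hh, Function.comp_assoc]⟩

theorem cons_comp_map {A ι κ : Type*} (a : A) (z : κ → A) (j : ι → κ) :
    cons a z ∘ Option.map j = cons a (z ∘ j) := by
  ext o
  cases o <;> rfl

/-- If `g` contains all or none of the points of type `μ`, it is the value of a term at `y`;
otherwise `Sim.exists_cons_of_maxLocated` applies. -/
theorem MaxLocated.exists_sim_cons {κ : Type*} [Finite κ] (hM : InV4 M) (hN : InV4 N)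
    (hS : Splitting M) {x : κ → M} {y : κ → N} (hxy : Sim x y) {g : N} {μ : κ → L5}
    (hμ : TwoValued μ) (hg : MaxLocated y μ g) : ∃ m : M, Sim (cons m x) (cons g y) := by
  by_cases h₁ : ∃ h : CoheytingHom N L5, h ∘ y = μ ∧ Rt (h g)
  · by_cases h₀ : ∃ h : CoheytingHom N L5, h ∘ y = μ ∧ ¬ Rt (h g)
    · exact hxy.exists_cons_of_maxLocated hM hS hμ hg h₁ h₀
    · push Not at h₀
      have : g = ev (typeTerm μ) y := by
        rw [hN.eq_iff]
        intro h
        change _ ↔ Rt (h (typeElt μ y))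
        rw [rt_typeElt_iff_of_twoValued hμ, pt_typeElt, qt_typeElt]
        constructor
        · exact fun h' => (hg.regular h h').imp (fun h' => (hg.fst_eq h h').symm)
            fun h' => (hg.snd_eq h h').symm
        · rintro (h' | h')
          · exact Pt.rt ((pt_iff_rt_fst h g).2 (h₀ (fstHom.comp h) h'.symm))
          · exact Qt.rt ((qt_iff_rt_snd h g).2 (h₀ (sndHom.comp h) h'.symm))
      exact ⟨_, this ▸ hxy.cons_ev (typeTerm μ)⟩
  · have : g = ev 0 y := by
      rw [hN.eq_iff]
      intro h
      simp only [ev_zero, map_bot, rt_bot, iff_false]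
      intro h'
      rcases hg.regular h h' with h' | h'
      · exact h₁ ⟨fstHom.comp h, hg.fst_eq h h', (pt_iff_rt_fst h g).1 h'⟩
      · exact h₁ ⟨sndHom.comp h, hg.snd_eq h h', (qt_iff_rt_snd h g).1 h'⟩
    exact ⟨_, this ▸ hxy.cons_ev 0⟩

/-- The tuple `Y` is invariant over `w`: its type is determined by the type of `w`. -/
def Invariant {κ ω : Type*} (w : ω → N) (Y : κ → N) : Prop :=
  ∀ h h' : CoheytingHom N L5, h ∘ w = h' ∘ w → h ∘ Y = h' ∘ Y

/-- The similar tuples `x` and `y` extend to similar tuples, the second one of which is invariant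
over `w` and contains the elements defining the types in `s`. -/
def HasStage {ι : Type v} {ω : Type*} [Finite ω] (x : ι → M) (y : ι → N) (w : ω → N)
    (s : Set (ω → L5)) : Prop :=
  ∃ (κ : Type v) (_ : Finite κ) (X : κ → M) (Y : κ → N) (j : ι → κ), Sim X Y ∧ X ∘ j = x ∧
    Y ∘ j = y ∧ Invariant w Y ∧ ∀ e ∈ s, ∃ i, Y i = typeElt e w

theorem HasStage.insert {ι : Type v} {ω : Type*} [Finite ω] {x : ι → M} {y : ι → N} {w : ω → N}
    {s : Set (ω → L5)} (hs : HasStage x y w s) (e : ω → L5)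
    (hstep : ∀ (κ : Type v) [Finite κ] (X : κ → M) (Y : κ → N), Sim X Y → Invariant w Y →
      (∀ e ∈ s, ∃ i, Y i = typeElt e w) → ∃ m : M, Sim (cons m X) (cons (typeElt e w) Y)) :
    HasStage x y w (insert e s) := by
  obtain ⟨κ, _, X, Y, j, h1, h2, h3, h4, h5⟩ := hs
  obtain ⟨m, hm⟩ := hstep κ X Y h1 h4 h5
  refine ⟨Option κ, inferInstance, _, _, some ∘ j, hm, h2, h3, fun h h' hh => ?_, ?_⟩
  · rw [comp_cons_eq_iff]
    exact ⟨h4 h h' hh, by rw [typeElt, map_ev, map_ev, hh]⟩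
  · rintro e' (rfl | he')
    · exact ⟨none, rfl⟩
    · obtain ⟨i, hi⟩ := h5 e' he'
      exact ⟨some i, hi⟩

theorem Invariant.twoValued_of_twoValued {κ ω : Type*} {w : ω → N} {Y : κ → N}
    (hY : Invariant w Y) {h : CoheytingHom N L5} (hw : TwoValued (h ∘ w)) :
    TwoValued (h ∘ Y) := by
  have : (fstHom.comp h) ∘ Y = h ∘ Y := hY _ _ (by rw [comp_tuple, hw.fst_eq])
  rw [← this, comp_tuple]
  exact twoValued_fst _

/-- By `hfine`, a point whose type over `w` is not two-valued lies in an entry of `Y` that has no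
leaf and determines this type up to `swapHom`. Hence its type over `Y` is not two-valued either. -/
theorem Invariant.maxLocated {κ ω : Type*} [Finite ω] {w : ω → N} {Y : κ → N} (hY : Invariant w Y)
    (hfine : ∀ e : ω → L5, ¬ TwoValued e → ∃ i, Y i = typeElt e w) {ν : ω → L5} (hν : TwoValued ν)
    (k : CoheytingHom N L5) (hk : k ∘ w = ν) : MaxLocated Y (k ∘ Y) (typeElt ν w) where
  regular h := (rt_typeElt_iff_of_twoValued hν).1
  fst_eq h h' := by
    rw [pt_typeElt] at h'
    exact hY (fstHom.comp h) k (by rw [hk, h', comp_tuple])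
  eq_or_swap h h' hh hd := by
    have he : ¬ TwoValued (h ∘ w) := fun he => hd (hY.twoValued_of_twoValued he)
    obtain ⟨i, hi⟩ := hfine _ he
    have h1 : Rt (h (Y i)) := by
      rw [hi, rt_typeElt_of_not_twoValued he]
      exact Or.inl rfl
    rw [show h (Y i) = h' (Y i) from congrFun hh i, hi, rt_typeElt_of_not_twoValued he] at h1
    rcases h1 with h1 | h1
    · left
      rw [typeElt, map_ev, map_ev, h1]
    · right
      refine ⟨?_, ?_⟩
      · rw [typeElt, map_ev, map_ev, h1, map_ev, swap_swap]
      · have h2 := hY h' (swapHom.comp h) h1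
        rw [comp_tuple] at h2
        rw [← h2, hh]
  twoValued h hd hr := by
    have he : TwoValued (h ∘ w) := by
      by_contra he
      obtain ⟨i, hi⟩ := hfine _ he
      have h1 : Rt (h (Y i)) := by
        rw [hi, rt_typeElt_of_not_twoValued he]
        exact Or.inl rfl
      have h2 := (hd i h1).1
      rw [Function.comp_apply, hi] at h2
      exact not_pt_typeElt he h2
    rw [rt_typeElt, pointType_of_twoValued he] at hr
    rw [pt_typeElt, qt_typeElt, he.fst_eq, he.snd_eq]
    exact ⟨hr, hr⟩

theorem Sim.hasStage_univ {ι : Type v} [Finite ι] {ω : Type*} [Finite ω] (hM : InV4 M)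
    (hN : InV4 N) (hS : Splitting M) (hD : Density M) {x : ι → M} {y : ι → N} (hxy : Sim x y)
    {w : ω → N} (hw : Invariant w y) : HasStage x y w Set.univ := by
  -- Types that are not two-valued come first: their elements contain no leaf, and invariance gives
  -- all points of one element the same type up to `swapHom`.
  have h1 : ∀ s : Set (ω → L5), s ⊆ {e | ¬ TwoValued e} → HasStage x y w s := by
    intro s hs
    induction s, s.toFinite using Set.Finite.induction_on with
    | empty => exact ⟨ι, inferInstance, x, y, id, hxy, rfl, rfl, hw, by simp⟩
    | @insert e s _ _ ih =>
      have he : ¬ TwoValued e := hs (Set.mem_insert _ _)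
      refine (ih ((Set.subset_insert _ _).trans hs)).insert e fun κ _ X Y hXY hY _ => ?_
      refine hXY.exists_cons_of_not_pt hM hS hD (fun h => not_pt_typeElt he) fun h h' hr hr' => ?_
      rw [rt_typeElt_of_not_twoValued he] at hr hr'
      have hsw : h ∘ w = h' ∘ w ∨ h ∘ w = (swapHom.comp h') ∘ w := by
        rw [comp_tuple]
        rcases hr with hr | hr <;> rcases hr' with hr' | hr' <;> simp [hr, hr', swap_swap]
      exact hsw.imp (hY h h') (hY h (swapHom.comp h'))
  -- The earlier entries now provide the hypothesis `hfine` of `Invariant.maxLocated`. The element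
  -- of an unrealised two-valued type is `⊥`.
  have h2 : ∀ s : Set (ω → L5), s ⊆ {e | TwoValued e} →
      HasStage x y w (s ∪ {e | ¬ TwoValued e}) := by
    intro s hs
    induction s, s.toFinite using Set.Finite.induction_on with
    | empty =>
      rw [Set.empty_union]
      exact h1 _ le_rfl
    | @insert e s _ _ ih =>
      have he : TwoValued e := hs (Set.mem_insert _ _)
      rw [Set.insert_union]
      refine (ih ((Set.subset_insert _ _).trans hs)).insert e fun κ _ X Y hXY hY hfine => ?_
      by_cases hk : ∃ k : CoheytingHom N L5, k ∘ w = e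
      · obtain ⟨k, hk⟩ := hk
        exact (hY.maxLocated (fun e he => hfine e (Or.inr he)) he k hk).exists_sim_cons hM hN hS hXY
          (hY.twoValued_of_twoValued (hk ▸ he))
      · have : typeElt e w = ev 0 Y := by
          rw [hN.eq_iff]
          intro h
          rw [rt_typeElt_iff_of_twoValued he, pt_typeElt, qt_typeElt]
          simp only [ev_zero, map_bot, rt_bot, iff_false, not_or]
          exact ⟨fun h' => hk ⟨fstHom.comp h, h'.symm⟩, fun h' => hk ⟨sndHom.comp h, h'.symm⟩⟩
        exact ⟨_, this ▸ hXY.cons_ev 0⟩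
  convert h2 {e | TwoValued e} le_rfl
  ext e
  simp [em]

/-- In a model satisfying density and splitting, every one-element extension of a similar tuple has
a counterpart. -/
theorem Sim.exists_cons {ι : Type v} [Finite ι] (hM : InV4 M) (hN : InV4 N) (hS : Splitting M)
    (hD : Density M) {x : ι → M} {y : ι → N} (hxy : Sim x y) (n : N) :
    ∃ m : M, Sim (cons m x) (cons n y) := by
  classical
  obtain ⟨κ, _, X, Y, j, hXY, hX, hY, -, hall⟩ := hxy.hasStage_univ hM hN hS hD
    (w := cons n y) fun h h' hh => (comp_cons_eq_iff.1 hh).1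
  choose i hi using fun e => hall e (Set.mem_univ e)
  let _ := Fintype.ofFinite ι
  -- The element `n` is the join of the type elements over `cons n y` of the types whose root lies
  -- in the coordinate `none`, that of `n`.
  let t : lang.Term κ := supT ((Finset.univ.filter fun e : Option ι → L5 => Rt (e none)).toList.map
    fun e => Term.var (i e))
  have hn : n = ev t Y := by
    rw [hN.eq_iff]
    intro h
    rw [map_ev, rt_supT]
    simp only [List.mem_map, Finset.mem_toList, Finset.mem_filter, Finset.mem_univ, true_and,
      exists_exists_and_eq_and, ev_var, Function.comp_apply, hi, rt_typeElt]
    refine ⟨fun h' => ⟨h ∘ cons n y, h', Or.inl rfl⟩, ?_⟩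
    have e1 : (h ∘ cons n y) none = h n := rfl
    have e2 : ∀ f : CoheytingHom L5 L5, (f ∘ (h ∘ cons n y)) none = f (h n) := fun f => rfl
    rintro ⟨e, he, h' | h' | h' | h'⟩
    · rwa [h', e1] at he
    · rwa [h', e2, rt_swap] at he
    · rw [h', e2, rt_fst] at he
      exact he.rt
    · rw [h', e2, rt_snd] at he
      exact he.rt
  refine ⟨ev t X, ?_⟩
  -- Restriction along `j` forgets the auxiliary entries.
  have h1 := (hXY.cons_ev t).comp (Option.map j)
  rw [← hn] at h1
  rwa [cons_comp_map, cons_comp_map, hX, hY] at h1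

end Extension

/-! ### First-order structures versus co-Heyting algebras. -/

section Bridge

theorem realize_identity {M : Type*} [lang.Structure M] {s t : lang.Term (Empty ⊕ Fin 3)} :
    M ⊨ identity s t ↔ ∀ xs : Fin 3 → M,
      s.realize (Sum.elim (default : Empty → M) xs) = t.realize (Sum.elim default xs) := by
  rw [identity, Sentence.Realize]
  exact BoundedFormula.realize_alls.trans
    (forall_congr' fun xs => BoundedFormula.realize_bdEqual _ _)

theorem realize_sup {M α : Type*} [lang.Structure M] (s t : lang.Term α) (v : α → M) :
    (s ⊔ t).realize v = Structure.funMap supSymb ![s.realize v, t.realize v] :=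
  Term.realize_functions_apply₂
theorem realize_inf {M α : Type*} [lang.Structure M] (s t : lang.Term α) (v : α → M) :
    (s ⊓ t).realize v = Structure.funMap infSymb ![s.realize v, t.realize v] :=
  Term.realize_functions_apply₂
theorem realize_sub {M α : Type*} [lang.Structure M] (s t : lang.Term α) (v : α → M) :
    (s - t).realize v = Structure.funMap subSymb ![s.realize v, t.realize v] :=
  Term.realize_functions_apply₂
theorem realize_zero {M α : Type*} [lang.Structure M] (v : α → M) :
    (0 : lang.Term α).realize v = Structure.funMap zeroSymb ![] :=
  Term.realize_constants.trans rfl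
theorem realize_one {M α : Type*} [lang.Structure M] (v : α → M) :
    (1 : lang.Term α).realize v = Structure.funMap oneSymb ![] :=
  Term.realize_constants.trans rfl

/-- The co-Heyting algebra with prescribed operations. -/
abbrev coheytingOfOperations {M : Type u} (zero one : M) (sup inf sub : M → M → M)
    (sup_comm : ∀ a b, sup a b = sup b a) (inf_comm : ∀ a b, inf a b = inf b a)
    (sup_assoc : ∀ a b c, sup a (sup b c) = sup (sup a b) c)
    (inf_assoc : ∀ a b c, inf a (inf b c) = inf (inf a b) c)
    (sup_inf : ∀ a b, sup a (inf a b) = a) (inf_sup : ∀ a b, inf a (sup a b) = a)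
    (distrib : ∀ a b c, inf a (sup b c) = sup (inf a b) (inf a c))
    (sup_zero : ∀ a, sup a zero = a) (inf_one : ∀ a, inf a one = a)
    (sub_self : ∀ a, sub a a = zero) (sup_sub : ∀ a b, sup a (sub b a) = sup a b)
    (sup_sub' : ∀ a b, sup b (sub b a) = b)
    (sup_sub_distrib : ∀ a b c, sub (sup b c) a = sup (sub b a) (sub c a)) :
    CoheytingAlgebra M :=
  letI : Max M := ⟨sup⟩
  letI : Min M := ⟨inf⟩
  letI lat : Lattice M := Lattice.mk' sup_comm (fun a b c => (sup_assoc a b c).symm) inf_comm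
    (fun a b c => (inf_assoc a b c).symm) sup_inf inf_sup
  letI dist : DistribLattice M := DistribLattice.ofInfSupLe fun a b c => (distrib a b c).le
  letI bd : BoundedOrder M :=
    { top := one
      le_top := fun a => inf_eq_left.1 (inf_one a)
      bot := zero
      bot_le := fun a => sup_eq_left.1 (sup_zero a) }
  CoheytingAlgebra.ofSDiff sub fun a b c => by
    have hself : sub b b = (⊥ : M) := sub_self b
    have hdist : ∀ a b c : M, sub (b ⊔ c) a = sub b a ⊔ sub c a := sup_sub_distrib
    have hsup : ∀ a b : M, a ⊔ sub b a = a ⊔ b := sup_sub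
    have hle : ∀ a b : M, sub b a ≤ b := fun a b => sup_eq_left.1 (sup_sub' a b)
    -- Monotonicity comes from distribution over joins, the last identity, and yields the
    -- adjunction.
    have hmono : ∀ a b c : M, a ≤ b → sub a c ≤ sub b c := fun a b c h => by
      rw [← sup_eq_right.2 h, hdist]
      exact le_sup_left
    constructor
    · intro h
      calc a ≤ b ⊔ a := le_sup_right
        _ = b ⊔ sub a b := (hsup b a).symm
        _ ≤ b ⊔ c := sup_le_sup_left h b
    · intro h
      calc sub a b ≤ sub (b ⊔ c) b := hmono _ _ _ h
        _ = sub c b := by rw [hdist, hself, bot_sup_eq]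
        _ ≤ c := hle _ _

theorem exists_coheyting_of_model {M : Type u} (S : lang.Structure M) (hM : V1.Model M) :
    ∃ _ : CoheytingAlgebra M, S = structureOfCoheyting M := by
  have H : ∀ φ ∈ V1, M ⊨ φ := fun φ hφ => hM.realize_of_mem φ hφ
  simp only [V1, Set.mem_insert_iff, Set.mem_singleton_iff, forall_eq_or_imp, forall_eq,
    realize_identity, realize_sup, realize_inf, realize_sub, realize_zero, realize_one,
    Term.realize_var, Sum.elim_inr] at H
  obtain ⟨h1, h2, h3, h4, h5, h6, h7, h8, h9, h10, h11, h12, h13⟩ := H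
  refine ⟨coheytingOfOperations (Structure.funMap zeroSymb ![]) (Structure.funMap oneSymb ![])
    (fun a b => Structure.funMap supSymb ![a, b]) (fun a b => Structure.funMap infSymb ![a, b])
    (fun a b => Structure.funMap subSymb ![a, b]) (fun a b => h1 ![a, b, a])
    (fun a b => h2 ![a, b, a]) (fun a b c => h3 ![a, b, c]) (fun a b c => h4 ![a, b, c])
    (fun a b => h5 ![a, b, a]) (fun a b => h6 ![a, b, a]) (fun a b c => h7 ![a, b, c])
    (fun a => h8 ![a, a, a]) (fun a => h9 ![a, a, a]) (fun a => h10 ![a, a, a])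
    (fun a b => h11 ![a, b, a]) (fun a b => h12 ![a, b, a]) (fun a b c => h13 ![a, b, c]), ?_⟩
  ext n f xs
  · cases f with
    | zero => exact congrArg (Structure.funMap zeroSymb) (Subsingleton.elim _ _)
    | one => exact congrArg (Structure.funMap oneSymb) (Subsingleton.elim _ _)
    | sup => exact congrArg (Structure.funMap supSymb) (by ext i; fin_cases i <;> rfl)
    | inf => exact congrArg (Structure.funMap infSymb) (by ext i; fin_cases i <;> rfl)
    | sub => exact congrArg (Structure.funMap subSymb) (by ext i; fin_cases i <;> rfl)
  · cases f

variable {M : Type u} [CoheytingAlgebra M]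

attribute [local instance] structureOfCoheyting

theorem realize_eq_ev {α : Type*} (t : lang.Term α) (v : α → M) : t.realize v = ev t v := rfl

theorem realize_identity_iff_ev {s t : lang.Term (Empty ⊕ Fin 3)} :
    M ⊨ identity s t ↔ ∀ xs : Fin 3 → M,
      ev s (Sum.elim (default : Empty → M) xs) = ev t (Sum.elim default xs) :=
  realize_identity

theorem model_V1 : V1.Model M := by
  rw [Theory.model_iff]
  simp only [V1, Set.mem_insert_iff, Set.mem_singleton_iff, forall_eq_or_imp, forall_eq,
    realize_identity_iff_ev, ev_sup, ev_inf, ev_sub, ev_zero, ev_one, ev_var, Sum.elim_inr]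
  refine ⟨fun v => sup_comm _ _, fun v => inf_comm _ _, fun v => (sup_assoc _ _ _).symm,
    fun v => (inf_assoc _ _ _).symm, fun v => sup_inf_self, fun v => inf_sup_self,
    fun v => inf_sup_left _ _ _, fun v => sup_bot_eq _, fun v => inf_top_eq _,
    fun v => sdiff_self, fun v => sup_sdiff_self _ _, fun v => sup_eq_left.2 sdiff_le,
    fun v => sup_sdiff⟩

theorem model_V4_iff : V4.Model M ↔ InV4 M := by
  rw [V4, V3, Theory.model_union_iff, Theory.model_union_iff, and_iff_right model_V1,
    Theory.model_singleton_iff, Theory.model_singleton_iff]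
  simp only [realize_identity_iff_ev, symDiffTerm, ev_sup, ev_inf, ev_sub, ev_zero, ev_one, ev_var,
    Sum.elim_inr]
  exact ⟨fun h => ⟨fun a b => h.1 ![a, b, a], fun a b => h.2 ![a, b, a]⟩,
    fun h => ⟨fun v => h.dim _ _, fun v => h.width _ _⟩⟩

theorem realize_leF {α : Type*} {n : ℕ} {s t : lang.Term (α ⊕ Fin n)} {v : α → M} {xs : Fin n → M} :
    (leF s t).Realize v xs ↔ ev s (Sum.elim v xs) ≤ ev t (Sum.elim v xs) := by
  rw [leF, BoundedFormula.realize_bdEqual]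
  exact inf_eq_left

theorem realize_neZeroF {α : Type*} {n : ℕ} {s : lang.Term (α ⊕ Fin n)} {v : α → M}
    {xs : Fin n → M} : (neZeroF s).Realize v xs ↔ ev s (Sum.elim v xs) ≠ ⊥ := by
  rw [neZeroF, BoundedFormula.realize_not, BoundedFormula.realize_bdEqual]
  rfl

theorem realize_llF {α : Type*} {n : ℕ} {s t : lang.Term (α ⊕ Fin n)} {v : α → M}
    {xs : Fin n → M} : (llF s t).Realize v xs ↔
      ev t (Sum.elim v xs) \ ev s (Sum.elim v xs) = ev t (Sum.elim v xs) ∧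
        ev s (Sum.elim v xs) ≤ ev t (Sum.elim v xs) := by
  rw [llF, BoundedFormula.realize_inf, realize_leF, BoundedFormula.realize_bdEqual]
  rfl

theorem realize_D4_iff : M ⊨ D4 ↔ Density M := by
  simp only [D4, Sentence.Realize, Formula.Realize, BoundedFormula.realize_all,
    BoundedFormula.realize_imp, BoundedFormula.realize_inf, BoundedFormula.realize_ex,
    BoundedFormula.realize_bdEqual, realize_neZeroF, realize_llF, realize_eq_ev, ev_sub, ev_one,
    ev_var, Sum.elim_inr, and_imp, Density]
  rfl

theorem realize_S4_iff : M ⊨ S4 ↔ Splitting M := by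
  simp only [S4, Sentence.Realize, Formula.Realize, BoundedFormula.realize_all,
    BoundedFormula.realize_imp, BoundedFormula.realize_inf, BoundedFormula.realize_ex,
    BoundedFormula.realize_bdEqual, realize_neZeroF, realize_llF, realize_leF, realize_eq_ev,
    ev_sub, ev_sup, ev_inf, ev_zero, ev_one, ev_var, Sum.elim_inr, and_imp, Splitting]
  simp only [and_assoc]
  rfl

theorem model_V4_D4_S4_iff :
    (V4 ∪ {D4, S4}).Model M ↔ InV4 M ∧ Density M ∧ Splitting M := by
  rw [Theory.model_union_iff, model_V4_iff, Set.insert_eq, Theory.model_union_iff,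
    Theory.model_singleton_iff, Theory.model_singleton_iff, realize_D4_iff, realize_S4_iff]

end Bridge

attribute [local instance] structureOfCoheyting

/-! ### Similarity preserves formulas. -/

section Preservation

variable {M : Type*} {N : Type*} [CoheytingAlgebra M] [CoheytingAlgebra N]

theorem Sim.ev_eq_of_ev_eq {ι : Type*} (hN : InV4 N) {x : ι → M} {y : ι → N} (hxy : Sim x y)
    {s t : lang.Term ι} (h : ev s x = ev t x) : ev s y = ev t y := by
  refine hN.eq_of_forall_hom fun h' => ?_
  obtain ⟨k, hk⟩ := hxy.2 h'
  rw [map_ev, map_ev, ← hk, ← map_ev, ← map_ev, h]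

theorem Sim.ev_eq_iff {ι : Type*} (hM : InV4 M) (hN : InV4 N) {x : ι → M} {y : ι → N}
    (hxy : Sim x y) {s t : lang.Term ι} : ev s x = ev t x ↔ ev s y = ev t y :=
  ⟨hxy.ev_eq_of_ev_eq hN, hxy.symm.ev_eq_of_ev_eq hM⟩

theorem Sim.realize_iff_of_isQF {α : Type*} {n : ℕ} (hM : InV4 M) (hN : InV4 N)
    {φ : lang.BoundedFormula α n} (hφ : φ.IsQF) {v : α → M} {xs : Fin n → M} {w : α → N}
    {ys : Fin n → N} (h : Sim (Sum.elim v xs) (Sum.elim w ys)) :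
    φ.Realize v xs ↔ φ.Realize w ys := by
  induction hφ with
  | falsum => exact Iff.rfl
  | of_isAtomic ha =>
    cases ha with
    | equal s t => exact h.ev_eq_iff hM hN
    | rel R ts => exact R.elim
  | imp _ _ ih₁ ih₂ => exact imp_congr ih₁ ih₂

theorem sum_elim_snoc {A α : Type*} {n : ℕ} (v : α → A) (xs : Fin n → A) (a : A) :
    Sum.elim v (Fin.snoc xs a : Fin (n + 1) → A) = cons a (Sum.elim v xs) ∘
      (Sum.elim (fun i => some (Sum.inl i))
        (Fin.lastCases none fun i => some (Sum.inr i)) : α ⊕ Fin (n + 1) → Option (α ⊕ Fin n)) := by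
  ext i
  rcases i with i | i
  · rfl
  · induction i using Fin.lastCases <;> simp [cons]

theorem Sim.snoc {α : Type*} {n : ℕ} {v : α → M} {xs : Fin n → M} {w : α → N} {ys : Fin n → N}
    {a : M} {b : N} (h : Sim (cons a (Sum.elim v xs)) (cons b (Sum.elim w ys))) :
    Sim (Sum.elim v (Fin.snoc xs a : Fin (n + 1) → M))
      (Sum.elim w (Fin.snoc ys b : Fin (n + 1) → N)) := by
  rw [sum_elim_snoc, sum_elim_snoc]
  exact h.comp _

/-- Witnesses in `N` are copied into `M` one at a time, so only `M` has to satisfy density and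
splitting. -/
theorem Sim.realize_of_isExistential {α : Type*} [Finite α] {n : ℕ} (hM : InV4 M) (hN : InV4 N)
    (hS : Splitting M) (hD : Density M) {φ : lang.BoundedFormula α n} (hφ : φ.IsExistential)
    {v : α → M} {xs : Fin n → M} {w : α → N} {ys : Fin n → N}
    (h : Sim (Sum.elim v xs) (Sum.elim w ys)) (hw : φ.Realize w ys) : φ.Realize v xs := by
  induction hφ with
  | of_isQF hφ => exact (h.realize_iff_of_isQF hM hN hφ).2 hw
  | ex _ ih =>
    rw [BoundedFormula.realize_ex] at hw ⊢
    obtain ⟨b, hb⟩ := hw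
    obtain ⟨a, ha⟩ := h.exists_cons hM hN hS hD b
    exact ⟨a, ih ha.snoc hb⟩

theorem Sim.realize_iff {α : Type*} [Finite α] {n : ℕ} (hM : InV4 M) (hN : InV4 N)
    (hSM : Splitting M) (hDM : Density M) (hSN : Splitting N) (hDN : Density N)
    (φ : lang.BoundedFormula α n) {v : α → M} {xs : Fin n → M} {w : α → N} {ys : Fin n → N}
    (h : Sim (Sum.elim v xs) (Sum.elim w ys)) : φ.Realize v xs ↔ φ.Realize w ys := by
  induction φ with
  | falsum => exact Iff.rfl
  | equal s t => exact h.ev_eq_iff hM hN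
  | rel R ts => exact R.elim
  | imp _ _ ih₁ ih₂ => exact imp_congr (ih₁ h) (ih₂ h)
  | all _ ih =>
    rw [BoundedFormula.realize_all, BoundedFormula.realize_all]
    constructor
    · intro H b
      obtain ⟨a, ha⟩ := h.exists_cons hM hN hSM hDM b
      exact (ih ha.snoc).1 (H a)
    · intro H a
      obtain ⟨b, hb⟩ := h.symm.exists_cons hN hM hSN hDN a
      exact (ih hb.symm.snoc).2 (H b)

theorem exists_comp_eq_iff {ι : Type*} [Finite ι] (hM : InV4 M) {x : ι → M} {d : ι → L5} :
    (∃ h : CoheytingHom M L5, h ∘ x = d) ↔ typeElt d x ≠ ⊥ := by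
  rw [hM.ne_bot_iff]
  constructor
  · rintro ⟨h, hh⟩
    exact ⟨h, rt_typeElt.2 (Or.inl hh.symm)⟩
  · rintro ⟨h, hh⟩
    rcases rt_typeElt.1 hh with h' | h' | h' | h'
    exacts [⟨h, h'.symm⟩, ⟨swapHom.comp h, h'.symm⟩, ⟨fstHom.comp h, h'.symm⟩,
      ⟨sndHom.comp h, h'.symm⟩]

theorem sim_of_typeElt {ι : Type*} [Finite ι] (hM : InV4 M) (hN : InV4 N) {x : ι → M} {y : ι → N}
    (H : ∀ d, typeElt d x ≠ ⊥ ↔ typeElt d y ≠ ⊥) : Sim x y :=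
  ⟨fun h => (exists_comp_eq_iff hN).2 ((H _).1 ((exists_comp_eq_iff hM).1 ⟨h, rfl⟩)),
    fun h => (exists_comp_eq_iff hM).2 ((H _).2 ((exists_comp_eq_iff hN).1 ⟨h, rfl⟩))⟩

theorem embedding_ev (f : M ↪[lang] N) {α : Type*} (t : lang.Term α) (v : α → M) :
    f (ev t v) = ev t (f ∘ v) :=
  (HomClass.realize_term f).symm

/-- Realising a type is the nonvanishing of a term, which embeddings preserve and reflect. -/
theorem sim_of_embedding (hM : InV4 M) (hN : InV4 N) (f : M ↪[lang] N) {ι : Type*} [Finite ι]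
    (x : ι → M) : Sim x (f ∘ x) := by
  refine sim_of_typeElt hM hN fun d => not_congr ?_
  have h0 : (⊥ : N) = f ⊥ := (embedding_ev f (0 : lang.Term Empty) (default : Empty → M)).symm
  rw [typeElt, typeElt, ← embedding_ev, h0, f.injective.eq_iff]

theorem comp_sum_elim_id {A α : Type*} (x : α → A) (xs : Fin 0 → A) :
    x ∘ (Sum.elim id Fin.elim0 : α ⊕ Fin 0 → α) = Sum.elim x xs := by
  ext i
  rcases i with i | i
  · rfl
  · exact i.elim0

theorem sim_sum_elim {α : Type*} {x : α → M} {y : α → N} {xs : Fin 0 → M} {ys : Fin 0 → N}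
    (h : Sim x y) : Sim (Sum.elim x xs) (Sum.elim y ys) := by
  rw [← comp_sum_elim_id x xs, ← comp_sum_elim_id y ys]
  exact h.comp _

end Preservation

/-! ### Quantifier elimination from realised types. -/

section QuantifierElimination

theorem isQF_iSup {L : FirstOrder.Language} {α β : Type*} [Finite β] {n : ℕ}
    {f : β → L.BoundedFormula α n} (hf : ∀ b, (f b).IsQF) : (BoundedFormula.iSup f).IsQF := by
  rw [BoundedFormula.iSup]
  induction (@Finset.univ β (Fintype.ofFinite β)).toList with
  | nil => exact BoundedFormula.isQF_bot
  | cons b l ih => exact (hf b).sup ih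

theorem isQF_iInf {L : FirstOrder.Language} {α β : Type*} [Finite β] {n : ℕ}
    {f : β → L.BoundedFormula α n} (hf : ∀ b, (f b).IsQF) : (BoundedFormula.iInf f).IsQF := by
  rw [BoundedFormula.iInf]
  induction (@Finset.univ β (Fintype.ofFinite β)).toList with
  | nil => exact BoundedFormula.IsQF.top
  | cons b l ih => exact (hf b).inf ih

theorem isQF_neZeroF {α : Type*} {n : ℕ} (s : lang.Term (α ⊕ Fin n)) : (neZeroF s).IsQF :=
  (BoundedFormula.IsAtomic.equal _ _).isQF.not

theorem isQF_leF {α : Type*} {n : ℕ} (s t : lang.Term (α ⊕ Fin n)) : (leF s t).IsQF :=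
  (BoundedFormula.IsAtomic.equal _ _).isQF

theorem isQF_llF {α : Type*} {n : ℕ} (s t : lang.Term (α ⊕ Fin n)) : (llF s t).IsQF :=
  (BoundedFormula.IsAtomic.equal _ _).isQF.inf (isQF_leF _ _)

/-- The formula expressing that the type `d` is realised. -/
noncomputable def typeFormula {n : ℕ} (d : Fin n → L5) : lang.Formula (Fin n) :=
  neZeroF ((typeTerm d).relabel Sum.inl : lang.Term (Fin n ⊕ Fin 0))

theorem realize_typeFormula {M : Type*} [CoheytingAlgebra M] {n : ℕ} {d : Fin n → L5}
    {v : Fin n → M} {xs : Fin 0 → M} :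
    BoundedFormula.Realize (typeFormula d) v xs ↔ typeElt d v ≠ ⊥ := by
  rw [typeFormula, realize_neZeroF, ← realize_eq_ev, Term.realize_relabel]
  rfl

open Classical in
/-- The formula expressing that the set of realised types is one of the members of `𝒟`. -/
noncomputable def typesFormula {n : ℕ} (𝒟 : Set (Set (Fin n → L5))) : lang.Formula (Fin n) :=
  BoundedFormula.iSup fun D : 𝒟 => BoundedFormula.iInf fun d : Fin n → L5 =>
    if d ∈ D.1 then typeFormula d else ∼(typeFormula d)

theorem isQF_typesFormula {n : ℕ} (𝒟 : Set (Set (Fin n → L5))) :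
    BoundedFormula.IsQF (typesFormula 𝒟) := by
  refine isQF_iSup fun D => isQF_iInf fun d => ?_
  split_ifs
  · exact isQF_neZeroF _
  · exact (isQF_neZeroF _).not

open Classical in
theorem realize_typesFormula {M : Type*} [CoheytingAlgebra M] {n : ℕ}
    {𝒟 : Set (Set (Fin n → L5))} {v : Fin n → M} {xs : Fin 0 → M} :
    BoundedFormula.Realize (typesFormula 𝒟) v xs ↔ {d | typeElt d v ≠ ⊥} ∈ 𝒟 := by
  rw [typesFormula, BoundedFormula.realize_iSup]
  have : ∀ D : 𝒟, (BoundedFormula.iInf fun d : Fin n → L5 =>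
      if d ∈ D.1 then typeFormula d else ∼(typeFormula d)).Realize v xs ↔
      {d | typeElt d v ≠ ⊥} = D.1 := by
    intro D
    rw [BoundedFormula.realize_iInf, Set.ext_iff]
    refine forall_congr' fun d => ?_
    rw [Set.mem_ofPred_eq]
    split_ifs with hd
    · rw [realize_typeFormula, iff_true_right hd]
    · rw [BoundedFormula.realize_not, realize_typeFormula, iff_false_right hd]
  simp only [this]
  exact ⟨fun ⟨D, hD⟩ => hD ▸ D.2, fun h => ⟨⟨_, h⟩, rfl⟩⟩

/-- The sets of types realised by tuples satisfying `φ`. -/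
def realizedTypes {n : ℕ} (φ : lang.Formula (Fin n)) : Set (Set (Fin n → L5)) :=
  {D | ∃ (M : Type) (_ : CoheytingAlgebra M), InV4 M ∧ Density M ∧ Splitting M ∧
    ∃ v : Fin n → M, φ.Realize v ∧ D = {d | typeElt d v ≠ ⊥}}

/-- Tuples in two models that realise the same types are similar, so by back and forth the truth of
`φ` depends only on that finite set of types. -/
theorem realize_iff_typesFormula {n : ℕ} (φ : lang.Formula (Fin n)) {M : Type}
    [S : lang.Structure M] (hM : (V4 ∪ {D4, S4}).Model M) (v : Fin n → M) (xs : Fin 0 → M) :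
    BoundedFormula.Realize φ v xs ↔
      BoundedFormula.Realize (typesFormula (realizedTypes φ)) v xs := by
  have hV1 : V1.Model M := hM.mono fun φ hφ => Or.inl (Or.inl (Or.inl hφ))
  obtain ⟨_, rfl⟩ := exists_coheyting_of_model S hV1
  obtain ⟨hV, hD, hS⟩ := model_V4_D4_S4_iff.1 hM
  rw [realize_typesFormula]
  constructor
  · intro h
    refine ⟨M, _, hV, hD, hS, v, ?_, rfl⟩
    rwa [Formula.Realize, Subsingleton.elim default xs]
  · rintro ⟨N, _, hVN, hDN, hSN, w, hw, hvw⟩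
    have hsim : Sim v w := sim_of_typeElt hV hVN fun d => Set.ext_iff.1 hvw d
    exact ((sim_sum_elim hsim).realize_iff hV hVN hS hD hSN hDN φ).2 hw

theorem eliminatesQuantifiers : EliminatesQuantifiers (V4 ∪ {D4, S4}) := fun _ φ =>
  ⟨typesFormula (realizedTypes φ), isQF_typesFormula _, fun M v xs =>
    BoundedFormula.realize_iff.2 (realize_iff_typesFormula φ M.is_model v xs)⟩

end QuantifierElimination

/-! ### Existentially closed algebras are the models of density and splitting. -/

section ExistentiallyClosed

theorem isExistentiallyClosed_of_model {M : Type u} [S : lang.Structure M]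
    (hM : (V4 ∪ {D4, S4}).Model M) : IsExistentiallyClosed.{u} V4 M := by
  have hV4 : V4.Model M := hM.mono fun φ hφ => Or.inl hφ
  refine ⟨hV4, fun N SN hN f n φ hφ a h => ?_⟩
  obtain ⟨_, rfl⟩ := exists_coheyting_of_model S (hV4.mono fun φ hφ => Or.inl (Or.inl hφ))
  obtain ⟨_, rfl⟩ := exists_coheyting_of_model SN (hN.mono fun φ hφ => Or.inl (Or.inl hφ))
  obtain ⟨hV, hD, hS⟩ := model_V4_D4_S4_iff.1 hM
  have hVN := model_V4_iff.1 hN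
  exact (sim_sum_elim (sim_of_embedding hV hVN f a)).realize_of_isExistential hV hVN hS hD hφ h

variable {M : Type u} [CoheytingAlgebra M]

/-- The embedding of structures given by an injective morphism of co-Heyting algebras. -/
def embeddingOfHom {A B : Type*} [CoheytingAlgebra A] [CoheytingAlgebra B] (f : CoheytingHom A B)
    (hf : Function.Injective f) : A ↪[lang] B where
  toFun := f
  inj' := hf
  map_fun' g xs := by
    cases g with
    | zero => exact map_bot f
    | one => exact map_top f
    | sup => exact map_sup f _ _
    | inf => exact map_inf f _ _
    | sub => exact map_sdiff f _ _
  map_rel' r := r.elim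

/-- The power of `L5` containing two copies of every morphism from `M` to `L5`. -/
abbrev DoublePower (M : Type u) [CoheytingAlgebra M] : Type u := CoheytingHom M L5 × Bool → L5

theorem inV4_pi {X : Type*} : InV4 (X → L5) :=
  ⟨fun a b => funext fun i => inV4_L5.dim (a i) (b i),
    fun a b => funext fun i => inV4_L5.width (a i) (b i)⟩

/-- The evaluation morphism from `M` to a power of `L5`. -/
noncomputable def toDoublePower (M : Type u) [CoheytingAlgebra M] :
    CoheytingHom M (DoublePower M) where
  toFun m p := p.1 m
  map_sup' a b := funext fun p => map_sup p.1 a b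
  map_inf' a b := funext fun p => map_inf p.1 a b
  map_top' := funext fun p => map_top p.1
  map_sdiff' a b := funext fun p => map_sdiff p.1 a b

theorem toDoublePower_injective (hM : InV4 M) : Function.Injective (toDoublePower M) :=
  fun _ _ hab => hM.eq_of_forall_hom fun h => congrFun hab (h, true)

theorem density_of_isExistentiallyClosed (hM : InV4 M) (hec : IsExistentiallyClosed.{u} V4 M) :
    Density M := by
  intro a ha hne
  let φ : lang.Formula (Fin 1) :=
    ∃' (neZeroF (Term.var (Sum.inr 0) : lang.Term (Fin 1 ⊕ Fin 1)) ⊓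
      llF (Term.var (Sum.inr 0)) (Term.var (Sum.inl 0)))
  have hφ : BoundedFormula.IsExistential φ :=
    .ex (.of_isQF ((isQF_neZeroF _).inf (isQF_llF _ _)))
  have key : ∀ {A : Type u} [CoheytingAlgebra A] (v : Fin 1 → A),
      φ.Realize v ↔ ∃ b : A, b ≠ ⊥ ∧ v 0 \ b = v 0 ∧ b ≤ v 0 := by
    intro A _ v
    simp only [φ, Formula.Realize, BoundedFormula.realize_ex, BoundedFormula.realize_inf,
      realize_neZeroF, realize_llF, ev_var, Sum.elim_inr, Sum.elim_inl]
    rfl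
  refine (key fun _ => a).1 (hec.2 (DoublePower M) (model_V4_iff.2 inV4_pi)
    (embeddingOfHom (toDoublePower M) (toDoublePower_injective hM)) 1 φ hφ (fun _ => a)
    ((key _).2 ?_))
  -- A nonzero regular element contains a leaf; evaluation there gives `⊤`. At the coordinates of
  -- this `h` the middle element `c` of `L5` satisfies `c ≪ ⊤`, and `⊥` serves elsewhere.
  obtain ⟨h, hh⟩ : ∃ h : CoheytingHom M L5, h a = ⊤ := by
    obtain ⟨h, hh⟩ := hM.ne_bot_iff.1 hne
    rw [ha] at hh
    simp only [map_sdiff, map_top, rt_sdiff, pt_sdiff, qt_sdiff, rt_top, pt_top, qt_top] at hh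
    have h1 := @Pt.rt (h a)
    have h2 := @Qt.rt (h a)
    by_cases h3 : Pt (h a)
    · refine ⟨fstHom.comp h, ?_⟩
      change fstHom (h a) = ⊤
      rw [L5.ext_iff]
      simp [h3]
    · refine ⟨sndHom.comp h, ?_⟩
      change sndHom (h a) = ⊤
      rw [L5.ext_iff]
      simp
      tauto
  classical
  let c : L5 := L5.ofPoints True False False
  have hc : Rt c ∧ ¬ Pt c ∧ ¬ Qt c := ⟨by simp [c, rt_ofPoints], by simp [c, pt_ofPoints],
    by simp [c, qt_ofPoints]⟩
  refine ⟨fun p => if p.1 = h then c else ⊥, fun h0 => ?_, ?_, ?_⟩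
  · have := congrFun h0 (h, true)
    simp only [if_true] at this
    exact hc.1 this
  · funext p
    change p.1 a \ (if p.1 = h then c else ⊥) = p.1 a
    split_ifs with hp
    · rw [hp, hh, L5.ext_iff, rt_sdiff, pt_sdiff, qt_sdiff]
      simp [hc]
    · exact sdiff_bot
  · intro p
    change (if p.1 = h then c else ⊥) ≤ p.1 a
    split_ifs with hp
    · rw [hp, hh]
      exact le_top
    · exact bot_le

-- This settles one coordinate; that the parts are nonzero is arranged at a duplicated coordinate.
set_option synthInstance.maxSize 1000 in
set_option synthInstance.maxHeartbeats 200000 in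
theorem L5.exists_splitting (a b₁ b₂ : L5) (h₁ : a \ (b₁ ⊔ b₂) = a) (h₂ : b₁ ⊔ b₂ ≤ a)
    (h₃ : (b₁ ⊓ b₂) ⊓ (⊤ \ a) = ⊥) : ∃ a₁ a₂ : L5, a \ a₂ = a₁ ∧ b₁ ≤ a₁ ∧ a \ a₁ = a₂ ∧
      b₂ ≤ a₂ ∧ a₁ ⊓ a₂ = b₁ ⊓ b₂ := by
  revert a b₁ b₂
  decide

theorem splitting_of_isExistentiallyClosed (hM : InV4 M) (hec : IsExistentiallyClosed.{u} V4 M) :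
    Splitting M := by
  intro a b₁ b₂ h₁ h₂ hne h₃
  let x : Fin 3 → lang.Term (Fin 3 ⊕ Fin 2) := fun i => Term.var (Sum.inl i)
  let y : Fin 2 → lang.Term (Fin 3 ⊕ Fin 2) := fun i => Term.var (Sum.inr i)
  let φ : lang.Formula (Fin 3) :=
    ∃' ∃' (neZeroF (y 0) ⊓ neZeroF (y 1) ⊓ (((x 0 - y 1) =' y 0) ⊓ leF (x 1) (y 0)) ⊓
      (((x 0 - y 0) =' y 1) ⊓ leF (x 2) (y 1)) ⊓ ((y 0 ⊓ y 1) =' (x 1 ⊓ x 2)))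
  have hφ : BoundedFormula.IsExistential φ :=
    .ex (.ex (.of_isQF (((((isQF_neZeroF _).inf (isQF_neZeroF _)).inf
      ((BoundedFormula.IsAtomic.equal _ _).isQF.inf (isQF_leF _ _))).inf
      ((BoundedFormula.IsAtomic.equal _ _).isQF.inf (isQF_leF _ _))).inf
      (BoundedFormula.IsAtomic.equal _ _).isQF)))
  have key : ∀ {A : Type u} [CoheytingAlgebra A] (v : Fin 3 → A),
      φ.Realize v ↔ ∃ a₁ a₂ : A, a₁ ≠ ⊥ ∧ a₂ ≠ ⊥ ∧ v 0 \ a₂ = a₁ ∧ v 1 ≤ a₁ ∧ v 0 \ a₁ = a₂ ∧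
        v 2 ≤ a₂ ∧ a₁ ⊓ a₂ = v 1 ⊓ v 2 := by
    intro A _ v
    simp only [φ, x, y, Formula.Realize, BoundedFormula.realize_ex, BoundedFormula.realize_inf,
      realize_neZeroF, realize_leF, BoundedFormula.realize_bdEqual, realize_eq_ev, ev_sub, ev_inf,
      ev_var, Sum.elim_inr, Sum.elim_inl, and_assoc]
    rfl
  refine (key ![a, b₁, b₂]).1 (hec.2 (DoublePower M) (model_V4_iff.2 inV4_pi)
    (embeddingOfHom (toDoublePower M) (toDoublePower_injective hM)) 3 φ hφ ![a, b₁, b₂]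
    ((key _).2 ?_))
  -- Since `a \ (b₁ ⊔ b₂) = a ≠ ⊥`, some root or leaf in `a` avoids both `bᵢ`. They impose nothing
  -- there, so one copy of the coordinate goes wholly to `a₁` and the other to `a₂`.
  obtain ⟨h, hha, hh1, hh2⟩ : ∃ h : CoheytingHom M L5, Rt (h a) ∧ h b₁ = ⊥ ∧ h b₂ = ⊥ := by
    obtain ⟨h, hh⟩ := hM.ne_bot_iff.1 hne
    have hbot : ∀ t : L5, ¬ Rt t → t = ⊥ := fun t ht => by simpa [Rt] using ht
    have e : h a \ (h b₁ ⊔ h b₂) = h a := by rw [← map_sup, ← map_sdiff, h₁]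
    rw [L5.ext_iff] at e
    simp only [rt_sdiff, pt_sdiff, qt_sdiff, rt_sup, pt_sup, qt_sup] at e
    obtain ⟨e1, e2, e3⟩ := e
    rcases e1.2 hh with h4 | h4 | h4
    · exact ⟨h, hh, hbot _ (by tauto), hbot _ (by tauto)⟩
    · refine ⟨fstHom.comp h, (pt_iff_rt_fst h a).1 h4.1, hbot _ ?_, hbot _ ?_⟩ <;>
        rw [← pt_iff_rt_fst] <;> tauto
    · refine ⟨sndHom.comp h, (qt_iff_rt_snd h a).1 h4.1, hbot _ ?_, hbot _ ?_⟩ <;>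
        rw [← qt_iff_rt_snd] <;> tauto
  have hex : ∀ p : CoheytingHom M L5 × Bool, ∃ a₁ a₂ : L5, p.1 a \ a₂ = a₁ ∧ p.1 b₁ ≤ a₁ ∧
      p.1 a \ a₁ = a₂ ∧ p.1 b₂ ≤ a₂ ∧ a₁ ⊓ a₂ = p.1 b₁ ⊓ p.1 b₂ ∧
      (p = (h, true) → a₁ = h a) ∧ (p = (h, false) → a₂ = h a) := by
    intro p
    by_cases hp : p.1 = h
    · obtain ⟨k, ε⟩ := p
      obtain rfl : k = h := hp
      cases ε
      · exact ⟨⊥, k a, by simp, by simp [hh1], by simp, by simp [hh2], by simp [hh1], by simp,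
          by simp⟩
      · exact ⟨k a, ⊥, by simp, by simp [hh1], by simp, by simp [hh2], by simp [hh2], by simp,
          by simp⟩
    · obtain ⟨a₁, a₂, g1, g2, g3, g4, g5⟩ := L5.exists_splitting (p.1 a) (p.1 b₁) (p.1 b₂)
        (by rw [← map_sup, ← map_sdiff, h₁])
        (by rw [← map_sup]; exact OrderHomClass.mono p.1 h₂)
        (by rw [← map_inf, ← map_top p.1, ← map_sdiff, ← map_inf, h₃, map_bot])
      exact ⟨a₁, a₂, g1, g2, g3, g4, g5, fun h' => absurd (congrArg Prod.fst h') hp,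
        fun h' => absurd (congrArg Prod.fst h') hp⟩
  choose a₁ a₂ g1 g2 g3 g4 g5 g6 g7 using hex
  refine ⟨a₁, a₂, fun h0 => ?_, fun h0 => ?_, funext g1, g2, funext g3, g4, funext g5⟩
  · exact hha ((g6 _ rfl).symm.trans (congrFun h0 (h, true)))
  · exact hha ((g7 _ rfl).symm.trans (congrFun h0 (h, false)))

theorem model_iff_isExistentiallyClosed (M : Type u) [S : lang.Structure M] :
    (V4 ∪ {D4, S4}).Model M ↔ IsExistentiallyClosed.{u} V4 M := by
  refine ⟨isExistentiallyClosed_of_model, fun h => ?_⟩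
  obtain ⟨_, rfl⟩ := exists_coheyting_of_model S (h.1.mono fun φ hφ => Or.inl (Or.inl hφ))
  have hV := model_V4_iff.1 h.1
  exact model_V4_D4_S4_iff.2 ⟨hV, density_of_isExistentiallyClosed hV h,
    splitting_of_isExistentiallyClosed hV h⟩

end ExistentiallyClosed

/-! ### The variety generated by `L5`. -/

section Variety

theorem exists_identity_of_mem_V4 {φ : lang.Sentence} (hφ : φ ∈ V4) :
    ∃ s t : lang.Term (Empty ⊕ Fin 3), φ = identity s t := by
  simp only [V4, V3, V1, Set.mem_union, Set.mem_insert_iff, Set.mem_singleton_iff] at hφ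
  rcases hφ with ((h | h | h | h | h | h | h | h | h | h | h | h | h) | h) | h <;>
    exact ⟨_, _, h⟩

/-- The variables of an identity as natural numbers. -/
def natVar : Empty ⊕ Fin 3 → ℕ := Sum.elim Empty.elim Fin.val

theorem comp_natVar {B : Type*} (v : ℕ → B) :
    v ∘ natVar = Sum.elim default fun i : Fin 3 => v i := by
  ext i
  rcases i with i | i
  · exact i.elim
  · rfl

theorem model_V4_of_inVarietyGeneratedBy {A : Type u} [lang.Structure A]
    (hA : InVarietyGeneratedBy L5 A) : V4.Model A := by
  have hL5 : V4.Model L5 := model_V4_iff.2 inV4_L5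
  refine (Theory.model_iff _).2 fun φ hφ => ?_
  obtain ⟨s, t, rfl⟩ := exists_identity_of_mem_V4 hφ
  have h1 := realize_identity.1 (hL5.realize_of_mem _ hφ)
  rw [realize_identity]
  intro xs
  have h2 := hA (s.relabel natVar) (t.relabel natVar)
    (fun v => by
      rw [Term.realize_relabel, Term.realize_relabel, comp_natVar]
      exact h1 _)
    -- Only the values at `0`, `1`, `2` matter; reduction modulo `3` extends the assignment to all
    -- of `ℕ`.
    (fun i => xs (Fin.ofNat 3 i))
  rw [Term.realize_relabel, Term.realize_relabel, comp_natVar] at h2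
  convert h2 using 3 <;> simp

theorem inVarietyGeneratedBy_of_model_V4 {A : Type u} [S : lang.Structure A] (hA : V4.Model A) :
    InVarietyGeneratedBy L5 A := by
  obtain ⟨_, rfl⟩ := exists_coheyting_of_model S (hA.mono fun φ hφ => Or.inl (Or.inl hφ))
  intro s t hst v
  refine (model_V4_iff.1 hA).eq_of_forall_hom fun h => ?_
  rw [realize_eq_ev, realize_eq_ev, map_ev, map_ev]
  exact hst _

end Variety

end CoHA

theorem mainTheorem2 :
    (∀ (A : Type u) [CoHA.lang.Structure A],
      CoHA.V4.Model A ↔ CoHA.InVarietyGeneratedBy CoHA.L5 A) ∧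
    CoHA.IsModelCompletion.{u} CoHA.V4 (CoHA.V4 ∪ {CoHA.D4, CoHA.S4}) :=
  ⟨fun _ _ => ⟨CoHA.inVarietyGeneratedBy_of_model_V4, CoHA.model_V4_of_inVarietyGeneratedBy⟩,
    fun M _ => CoHA.model_iff_isExistentiallyClosed M, CoHA.eliminatesQuantifiers⟩
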